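/- Let $N\ge 2$ be an integer and let $\mathcal D\subset\{0,1,\dots,N-1\}^2$ with $1<|\mathcal D|<N^2$. For $i\in\mathcal D$ put $\varphi_i(x)=\frac1N(x+i)$, $x\in\mathbb R^2$, and let $F=F(N,\mathcal D)$ (a generalized Sierpiński carpet) be the unique non-empty compact set with $F=\bigcup_{i\in\mathcal D}\varphi_i(F)$; equivalently $F=\bigcap_{n\ge 0}Q_n$, where $Q_0=[0,1]^2$ and $Q_{n+1}=\bigcup_{i\in\mathcal D}\varphi_i(Q_n)$. For a word $\mathbf i=i_1\cdots i_k\in\mathcal D^k$ put $\varphi_{\mathbf i}=\varphi_{i_1}\circ\cdots\circ\varphi_{i_k}$. Let $\Gamma_2$ be the graph with vertex set $\mathcal D^2$ in which distinct words $\mathbf i,\mathbf j$ are joined by an edge if and only if $\varphi_{\mathbf i}(F)\cap\varphi_{\mathbf j}(F)\ne\varnothing$. For a finite connected graph $G$, a vertex $v$ is a cut vertex if $G-\{v\}$ is disconnected; in that case let $G_1(v),G_2(v),\dots$ be the connected components of $G-\{v\}$ listed (with repetitions of size allowed) so that their numbers of vertices are non-increasing. Put $\chi(G)=\max\{|G_2(v)|: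 v \text{ a cut vertex of } G\}$ if $G$ has cut vertices, and $\chi(G)=0$ otherwise. A point $x\in F$ is a cut point of a connected set $F$ if $F\setminus\{x\}$ is not connected. If $F$ is connected and $\chi(\Gamma_2)<|\mathcal D|-1$, then $F$ has no cut points. -/

import Mathlib

/-- Deleting a vertex: the subgraph `G - {v}`. -/
abbrev deleteVertex {V : Type*} (G : SimpleGraph V) (v : V) :
    SimpleGraph ({v}ᶜ : Set V) :=
  G.induce ({v}ᶜ : Set V)

/-- `v` is a cut vertex of `G` if `G - {v}` is disconnected. -/
def IsCutVertex {V : Type*} (G : SimpleGraph V) (v : V) : Prop :=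
  ¬ (deleteVertex G v).Preconnected

open Classical in
/-- The numbers of vertices of the connected components of a finite graph,
listed (with repetitions) in decreasing order. -/
noncomputable def componentSizes {V : Type*} [Finite V] (G : SimpleGraph V) : List ℕ :=
  letI : Fintype G.ConnectedComponent := Fintype.ofFinite _
  ((Finset.univ : Finset G.ConnectedComponent).val.map fun c => c.supp.ncard).sort (· ≥ ·)

/-- `|G₂(v)|`: the number of vertices of the second largest connected component of `G - {v}`
(the entry of index `1` of the decreasing list; the default value `0` is used only when
`G - {v}` has fewer than two components, that is, when `v` is not a cut vertex). -/
noncomputable def secondComponentSize {V : Type*} [Finite V] (G : SimpleGraph V) (v : V) : ℕ :=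
  (componentSizes (deleteVertex G v)).getD 1 0

open Classical in
/-- `χ(G)`: the maximum of `|G₂(v)|` over the cut vertices `v` of `G`, and `0` if there are no
cut vertices (the supremum in `ℕ` of the empty family). -/
noncomputable def chi {V : Type*} [Fintype V] (G : SimpleGraph V) : ℕ :=
  ((Finset.univ : Finset V).filter fun v => IsCutVertex G v).sup (secondComponentSize G)

/-- `x` is a cut point of the (connected) set `X`: it is a point of `X` and `X \ {x}` is no
longer connected. -/
def IsCutPoint {E : Type*} [TopologicalSpace E] (X : Set E) (x : E) : Prop :=
  x ∈ X ∧ ¬ IsConnected (X \ {x})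

/-- The similarity map `φ_i(x) = (x + i) / N` of the plane. -/
noncomputable def gscMap (N : ℕ) (i : Fin N × Fin N) (x : ℝ × ℝ) : ℝ × ℝ :=
  (1 / (N : ℝ)) • (x + (((i.1 : ℕ) : ℝ), ((i.2 : ℕ) : ℝ)))

/-- The `n`-th approximation `Q_n`: `Q_0 = [0,1]²` and `Q_{n+1} = ⋃_{i ∈ D} φ_i(Q_n)`. -/
def gscApprox (N : ℕ) (D : Finset (Fin N × Fin N)) : ℕ → Set (ℝ × ℝ)
  | 0 => Set.Icc 0 1 ×ˢ Set.Icc 0 1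
  | n + 1 => ⋃ i ∈ D, gscMap N i '' gscApprox N D n

/-- The generalized Sierpiński carpet `F(N,D) = ⋂ Q_n`. By `gsc_isAttractor` and
`gsc_unique` below it is the unique non-empty compact set `K` with `K = ⋃_{i ∈ D} φ_i(K)`, that
is, the attractor of the iterated function system `(φ_i)_{i ∈ D}`. -/
def gsc (N : ℕ) (D : Finset (Fin N × Fin N)) : Set (ℝ × ℝ) :=
  ⋂ n, gscApprox N D n

/-- `φ_w = φ_{w_1} ∘ ⋯ ∘ φ_{w_k}` for a word `w = w_1 ⋯ w_k` over `D`. -/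
noncomputable def gscWordMap (N : ℕ) (D : Finset (Fin N × Fin N)) :
    (k : ℕ) → (Fin k → D) → ℝ × ℝ → ℝ × ℝ
  | 0, _ => id
  | k + 1, w => gscMap N (w 0 : Fin N × Fin N) ∘ gscWordMap N D k (Fin.tail w)

/-- The cell `φ_w(F)` of a word `w` of length `k`. -/
def gscCell (N : ℕ) (D : Finset (Fin N × Fin N)) (k : ℕ) (w : Fin k → D) : Set (ℝ × ℝ) :=
  gscWordMap N D k w '' gsc N D

/-- The `k`-th Hata graph `Γ_k(N,D)`: its vertices are the words of length `k` over `D`, and two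
distinct words are joined by an edge if and only if their cells intersect. -/
def hataGraph (N : ℕ) (D : Finset (Fin N × Fin N)) (k : ℕ) : SimpleGraph (Fin k → D) where
  Adj v w := v ≠ w ∧ (gscCell N D k v ∩ gscCell N D k w).Nonempty
  symm := ⟨fun _ _ h => ⟨h.1.symm, by rw [Set.inter_comm]; exact h.2⟩⟩
  loopless := ⟨fun _ h => h.1 rfl⟩

theorem gscMap_continuous (N : ℕ) (i : Fin N × Fin N) : Continuous (gscMap N i) := by
  unfold gscMap; fun_prop

theorem gscMap_dist (N : ℕ) (i : Fin N × Fin N) (x y : ℝ × ℝ) :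
    dist (gscMap N i x) (gscMap N i y) = (1 / (N : ℝ)) * dist x y := by
  unfold gscMap
  rw [dist_smul₀, dist_add_right, Real.norm_of_nonneg (by positivity)]

theorem gscMap_mem_square (N : ℕ) (i : Fin N × Fin N) (x : ℝ × ℝ)
    (hx : x ∈ gscApprox N ∅ 0) : gscMap N i x ∈ gscApprox N ∅ 0 := by
  have hN : (0 : ℝ) < N := by
    have := i.1.pos
    exact_mod_cast this
  have h1 : ((i.1 : ℕ) : ℝ) + 1 ≤ N := by exact_mod_cast i.1.isLt
  have h2 : ((i.2 : ℕ) : ℝ) + 1 ≤ N := by exact_mod_cast i.2.isLt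
  have h3 : (0 : ℝ) ≤ ((i.1 : ℕ) : ℝ) := by positivity
  have h4 : (0 : ℝ) ≤ ((i.2 : ℕ) : ℝ) := by positivity
  simp only [gscApprox, Set.mem_prod, Set.mem_Icc] at hx ⊢
  obtain ⟨⟨a, b⟩, c, d⟩ := hx
  simp only [gscMap, Prod.smul_fst, Prod.smul_snd, Prod.fst_add, Prod.snd_add, smul_eq_mul,
    one_div, inv_mul_eq_div, div_le_one hN]
  refine ⟨⟨?_, by linarith⟩, ?_, by linarith⟩
  · exact div_nonneg (by linarith) hN.le
  · exact div_nonneg (by linarith) hN.le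

theorem gscApprox_antitone (N : ℕ) (D : Finset (Fin N × Fin N)) : Antitone (gscApprox N D) := by
  refine antitone_nat_of_succ_le fun n => ?_
  induction n with
  | zero =>
    intro x hx
    simp only [gscApprox, Set.mem_iUnion] at hx
    obtain ⟨i, -, y, hy, rfl⟩ := hx
    exact gscMap_mem_square N i y hy
  | succ n ih => exact Set.iUnion₂_mono fun i _ => Set.image_mono ih

theorem gscApprox_isCompact (N : ℕ) (D : Finset (Fin N × Fin N)) (n : ℕ) :
    IsCompact (gscApprox N D n) := by
  induction n with
  | zero => exact isCompact_Icc.prod isCompact_Icc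
  | succ n ih =>
    exact D.isCompact_biUnion fun i _ => ih.image (gscMap_continuous N i)

theorem gscApprox_nonempty (N : ℕ) (D : Finset (Fin N × Fin N)) (hD : D.Nonempty) (n : ℕ) :
    (gscApprox N D n).Nonempty := by
  induction n with
  | zero => exact ⟨(0, 0), by simp [gscApprox]⟩
  | succ n ih =>
    obtain ⟨i, hi⟩ := hD
    obtain ⟨x, hx⟩ := ih
    exact ⟨gscMap N i x, Set.mem_biUnion hi ⟨x, hx, rfl⟩⟩

/-- `F(N,D)` is non-empty, compact, and equal to `⋃_{i ∈ D} φ_i(F(N,D))`. -/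
theorem gsc_isAttractor (N : ℕ) (D : Finset (Fin N × Fin N)) (hD : D.Nonempty) :
    (gsc N D).Nonempty ∧ IsCompact (gsc N D) ∧ gsc N D = ⋃ i ∈ D, gscMap N i '' gsc N D := by
  have hcl : ∀ n, IsClosed (gscApprox N D n) := fun n => (gscApprox_isCompact N D n).isClosed
  refine ⟨?_, ?_, ?_⟩
  · exact IsCompact.nonempty_iInter_of_sequence_nonempty_isCompact_isClosed _
      (fun n => gscApprox_antitone N D n.le_succ) (gscApprox_nonempty N D hD)
      (gscApprox_isCompact N D 0) hcl
  · exact (gscApprox_isCompact N D 0).of_isClosed_subset (isClosed_iInter hcl)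
      (Set.iInter_subset _ 0)
  · apply Set.Subset.antisymm
    · intro x hx
      have hx' : ∀ n, ∃ i ∈ D, x ∈ gscMap N i '' gscApprox N D n := by
        intro n
        have := Set.mem_iInter.1 hx (n + 1)
        simpa only [gscApprox, Set.mem_iUnion, exists_prop] using this
      choose f hfD hf using hx'
      obtain ⟨i, hi⟩ : ∃ i : D, Set.Infinite {n | (⟨f n, hfD n⟩ : D) = i} := by
        obtain ⟨i, hi⟩ := Finite.exists_infinite_fiber (fun n => (⟨f n, hfD n⟩ : D))
        exact ⟨i, Set.infinite_coe_iff.1 hi⟩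
      refine Set.mem_biUnion i.2 ?_
      have hN : (N : ℝ) ≠ 0 := by
        have := i.1.1.pos
        exact_mod_cast this.ne'
      have hinj : Function.Injective (gscMap N (i : Fin N × Fin N)) := by
        intro a b hab
        have h := gscMap_dist N (i : Fin N × Fin N) a b
        rw [hab, dist_self] at h
        have h' : dist a b = 0 := by
          rcases mul_eq_zero.1 h.symm with h | h
          · exact absurd h (one_div_ne_zero hN)
          · exact h
        exact dist_eq_zero.1 h'
      obtain ⟨n0, hn0⟩ := hi.nonempty
      obtain ⟨y, -, hy⟩ := hf n0
      have hn0' : f n0 = i := congrArg Subtype.val hn0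
      refine ⟨y, Set.mem_iInter.2 fun m => ?_, by rw [← hn0']; exact hy⟩
      obtain ⟨n, hn, hmn⟩ := hi.exists_gt m
      have hn' : f n = i := congrArg Subtype.val hn
      obtain ⟨z, hz, hzx⟩ := hf n
      have : z = y := hinj (by rw [← hn', hzx, hn', ← hn0', hy])
      exact gscApprox_antitone N D hmn.le (this ▸ hz)
    · intro x hx
      simp only [Set.mem_iUnion] at hx
      obtain ⟨i, hi, y, hy, rfl⟩ := hx
      refine Set.mem_iInter.2 fun n => gscApprox_antitone N D n.le_succ ?_
      exact Set.mem_biUnion hi ⟨y, Set.mem_iInter.1 hy n, rfl⟩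

/-- `F(N,D)` is the only non-empty compact set `K` with `K = ⋃_{i ∈ D} φ_i(K)`. -/
theorem gsc_unique (N : ℕ) (hN : 2 ≤ N) (D : Finset (Fin N × Fin N)) (K : Set (ℝ × ℝ))
    (hne : K.Nonempty) (hc : IsCompact K) (hK : K = ⋃ i ∈ D, gscMap N i '' K) :
    K = gsc N D := by
  have key : ∀ A B : Set (ℝ × ℝ), IsCompact A → IsCompact B → B.Nonempty →
      A = ⋃ i ∈ D, gscMap N i '' A → B = ⋃ i ∈ D, gscMap N i '' B → A ⊆ B := by
    intro A B hA hB hBne hA' hB'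
    obtain ⟨C, hC⟩ := Metric.isBounded_iff.1 (hA.union hB).isBounded
    obtain ⟨b0, hb0⟩ := hBne
    have step : ∀ n : ℕ, ∀ a ∈ A, ∃ b ∈ B, dist a b ≤ (1 / (N : ℝ)) ^ n * C := by
      intro n
      induction n with
      | zero => exact fun a ha => ⟨b0, hb0, by simpa using hC (Or.inl ha) (Or.inr hb0)⟩
      | succ n ih =>
        intro a ha
        rw [hA'] at ha
        simp only [Set.mem_iUnion] at ha
        obtain ⟨i, hi, a', ha', rfl⟩ := ha
        obtain ⟨b, hb, hab⟩ := ih a' ha'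
        refine ⟨gscMap N i b, ?_, ?_⟩
        · rw [hB']
          exact Set.mem_biUnion hi ⟨b, hb, rfl⟩
        · rw [gscMap_dist, pow_succ', mul_assoc]
          exact mul_le_mul_of_nonneg_left hab (by positivity)
    intro a ha
    have hN1 : (1 / (N : ℝ)) < 1 := by
      rw [div_lt_one (by positivity)]
      exact_mod_cast hN
    have hlim : Filter.Tendsto (fun n : ℕ => (1 / (N : ℝ)) ^ n * C) Filter.atTop (nhds 0) := by
      simpa using (tendsto_pow_atTop_nhds_zero_of_lt_one (by positivity) hN1).mul_const C
    rw [← hB.isClosed.closure_eq, Metric.mem_closure_iff]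
    intro ε hε
    obtain ⟨n, hn⟩ := (hlim.eventually (gt_mem_nhds hε)).exists
    obtain ⟨b, hb, hab⟩ := step n a ha
    exact ⟨b, hb, hab.trans_lt hn⟩
  have hD : D.Nonempty := by
    rw [Finset.nonempty_iff_ne_empty]
    rintro rfl
    rw [hK] at hne
    simp at hne
  obtain ⟨h1, h2, h3⟩ := gsc_isAttractor N D hD
  exact (key K _ hc h2 h1 hK h3).antisymm (key _ K h2 hc hne h3 hK)

/-! The hypothesis on `chi` enters only through `NoLargeSplit`: deleting one word `il` from `Γ₂`
never leaves two sides without contact that both contain a linked set of at least `|D| - 1` words.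
Suppose now that `x` separates `F`.

Fragility (`not_isFragileAt`): the digits cannot fall into two classes whose cells share only one
point `p`. A single contact point has a unique next digit (`code_unique_of_single_contact`), so if
only one cell `i` of a class contains `p`, all contact passes through one word `il`. Then
`NoLargeSplit` forces the class to be `{i}` and `D \ {l}` to be unlinked. If both classes have one
cell at `p`, this leaves two digits and is absurd. If only one class does, `l` is a corner digit,
and a corner can disconnect the digits only by producing a fragile point of the former kind. If
neither does, four cells meet at `p`, and translating one contact yields a second common point.

Descent (`false_of_separation_seq`): if `x` lies in one first-level cell `i` only, the separation
rescales to one by `zoom i x`. If this goes on forever, at each level all the other cells lie on one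
side. That side cannot be constant from some level on, since a point of the opposite side would be
expanded away from `x` by the factor `N` at every step. When the side changes, the contacts of the
current cell with the others are trapped in prescribed smaller cells. Either one of them has a
purely periodic code, and the side never changes again, or they all coincide, and `F` is fragile.

Several cells at `x` (`isPreconnected_sdiff_of_stable`): if the rescalings of `x` do not separate
`F`, no cell is separated by `x`, so `F` is fragile at `x`. Rescalings of a point in several cells
lie on the boundary of the square, those of such a boundary point are corners, and a corner lies in
at most one cell. Hence corners, boundary points and all points are treated in turn. -/

/-! ### Linked vertex sets and the second largest component -/

/-- A partition into two classes of a set of vertices always has an edge across. -/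
def LinkedIn {V : Type*} (r : V → V → Prop) (S : Set V) : Prop :=
  ∀ C ⊆ S, C.Nonempty → (S \ C).Nonempty → ∃ a ∈ C, ∃ b ∈ S \ C, r a b

theorem List.le_getD_one_of_two_le_countP {l : List ℕ} (hl : l.Pairwise (· ≥ ·)) {k : ℕ}
    (h : 2 ≤ l.countP (fun n => decide (k ≤ n))) : k ≤ l.getD 1 0 := by
  match l, hl, h with
  | [], _, h => simp at h
  | [a], _, h =>
    exact absurd (h.trans List.countP_le_length) (by simp)
  | a :: b :: t, hl, h =>
    simp only [List.getD_cons_succ, List.getD_cons_zero]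
    by_contra hb
    have hz : (b :: t).countP (fun n => decide (k ≤ n)) = 0 := by
      rw [List.countP_eq_zero]
      intro n hn
      have : n ≤ b := by
        rcases List.mem_cons.1 hn with rfl | hn
        · exact le_rfl
        · exact List.rel_of_pairwise_cons (List.pairwise_cons.1 hl).2 hn
      simp; omega
    rw [List.countP_cons, hz] at h
    split at h <;> omega

theorem le_componentSizes_getD_one {V : Type*} [Finite V] (G : SimpleGraph V) {k : ℕ}
    {c₁ c₂ : G.ConnectedComponent} (hne : c₁ ≠ c₂) (h₁ : k ≤ c₁.supp.ncard)
    (h₂ : k ≤ c₂.supp.ncard) : k ≤ (componentSizes G).getD 1 0 := by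
  classical
  unfold componentSizes
  let : Fintype G.ConnectedComponent := Fintype.ofFinite _
  apply List.le_getD_one_of_two_le_countP
  · exact Multiset.pairwise_sort _ _
  · rw [← Multiset.coe_countP, Multiset.sort_eq, Multiset.countP_map]
    have hsub : ({c₁, c₂} : Finset G.ConnectedComponent) ⊆
        Finset.univ.filter fun c => k ≤ c.supp.ncard := by
      intro c hc
      simp only [Finset.mem_insert, Finset.mem_singleton] at hc
      rcases hc with rfl | rfl <;> simpa
    have := Finset.card_le_card hsub
    rw [Finset.card_pair hne] at this
    simpa [Finset.card_def, Finset.filter_val] using this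

/-- A linked set of vertices avoiding `v` lies in a single component of `G - {v}`. -/
theorem exists_component_of_linkedIn {V : Type*} [Finite V] (G : SimpleGraph V) {v : V}
    {U : Set V} (hv : v ∉ U) (hU : LinkedIn G.Adj U) {a : V} (ha : a ∈ U) :
    U.ncard ≤ ((deleteVertex G v).connectedComponentMk
      ⟨a, fun h => hv (h ▸ ha)⟩).supp.ncard := by
  set c := (deleteVertex G v).connectedComponentMk ⟨a, fun h => hv (h ▸ ha)⟩ with hc
  have hsub : U ⊆ Subtype.val '' c.supp := by
    by_contra hcon
    obtain ⟨b, ⟨hbU, y, hyc, rfl⟩, b', ⟨hb'U, hb'⟩, hadj⟩ :=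
      hU (U ∩ Subtype.val '' c.supp) Set.inter_subset_left
        ⟨a, ha, ⟨a, fun h => hv (h ▸ ha)⟩, rfl, rfl⟩ (by
          rw [Set.sdiff_self_inter]
          exact Set.sdiff_nonempty.2 hcon)
    refine hb' ⟨hb'U, ⟨b', fun h => hv (h ▸ hb'U)⟩, ?_, rfl⟩
    rw [SimpleGraph.ConnectedComponent.mem_supp_iff] at hyc ⊢
    rw [← hyc, SimpleGraph.ConnectedComponent.eq]
    apply SimpleGraph.Adj.reachable
    exact hadj.symm
  calc U.ncard ≤ (Subtype.val '' c.supp).ncard := Set.ncard_le_ncard hsub (Set.toFinite _)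
    _ = c.supp.ncard := Set.ncard_image_of_injective _ Subtype.val_injective

/-- `P` propagates along walks avoiding `v`, so `U₁` and `U₂` sit in different components of `G -
{v}`. -/
theorem le_chi_of_split {V : Type*} [Fintype V] (G : SimpleGraph V) (v : V) (P : V → Prop)
    (hP : ∀ a b, a ≠ v → b ≠ v → P a → ¬ P b → ¬ G.Adj a b) {U₁ U₂ : Set V}
    (hv₁ : v ∉ U₁) (hv₂ : v ∉ U₂) (hU₁ : LinkedIn G.Adj U₁) (hU₂ : LinkedIn G.Adj U₂)
    (hP₁ : ∀ a ∈ U₁, P a) (hP₂ : ∀ a ∈ U₂, ¬ P a) {k : ℕ} (hk : 0 < k)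
    (hk₁ : k ≤ U₁.ncard) (hk₂ : k ≤ U₂.ncard) : k ≤ chi G := by
  classical
  obtain ⟨a, ha⟩ : U₁.Nonempty := Set.nonempty_of_ncard_ne_zero (by omega)
  obtain ⟨b, hb⟩ : U₂.Nonempty := Set.nonempty_of_ncard_ne_zero (by omega)
  have hpres : ∀ x y : ({v}ᶜ : Set V), (deleteVertex G v).Reachable x y → P x → P y := by
    rintro x y ⟨p⟩
    induction p with
    | nil => exact id
    | @cons u w _ h _ ih =>
      intro hx
      apply ih
      by_contra hy
      exact hP u w u.2 w.2 hx hy h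
  have hnr : ¬ (deleteVertex G v).Reachable ⟨a, fun h => hv₁ (h ▸ ha)⟩
      ⟨b, fun h => hv₂ (h ▸ hb)⟩ := fun h => hP₂ b hb (hpres _ _ h (hP₁ a ha))
  have hcut : IsCutVertex G v := fun h => hnr (h _ _)
  have hne : (deleteVertex G v).connectedComponentMk ⟨a, fun h => hv₁ (h ▸ ha)⟩ ≠
      (deleteVertex G v).connectedComponentMk ⟨b, fun h => hv₂ (h ▸ hb)⟩ :=
    fun h => hnr (SimpleGraph.ConnectedComponent.eq.1 h)
  have := le_componentSizes_getD_one _ hne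
    (hk₁.trans (exists_component_of_linkedIn G hv₁ hU₁ ha))
    (hk₂.trans (exists_component_of_linkedIn G hv₂ hU₂ hb))
  refine this.trans ?_
  exact Finset.le_sup (f := secondComponentSize G) (by simpa using hcut)

/-! ### Coordinates, digits and first-level cells (`!k` is the other axis) -/

/-- The `k`-th coordinate of a point of the plane. -/
def coord (k : Bool) (x : ℝ × ℝ) : ℝ := cond k x.1 x.2

/-- The `k`-th coordinate of a digit. -/
def digit {N : ℕ} (k : Bool) (d : Fin N × Fin N) : ℤ := cond k ((d.1 : ℕ) : ℤ) ((d.2 : ℕ) : ℤ)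

/-- The inverse `x ↦ N x - d` of `φ_d`. -/
def zoom {N : ℕ} (d : Fin N × Fin N) (x : ℝ × ℝ) : ℝ × ℝ :=
  ((N : ℝ) * x.1 - ((d.1 : ℕ) : ℝ), (N : ℝ) * x.2 - ((d.2 : ℕ) : ℝ))

/-- The first-level cell `φ_d(F)`. -/
def cell (N : ℕ) (D : Finset (Fin N × Fin N)) (d : Fin N × Fin N) : Set (ℝ × ℝ) :=
  gscMap N d '' gsc N D

/-- Two cells touch if they intersect. -/
def Touch (N : ℕ) (D : Finset (Fin N × Fin N)) (d e : Fin N × Fin N) : Prop :=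
  (cell N D d ∩ cell N D e).Nonempty

theorem coord_ext {x y : ℝ × ℝ} (h : ∀ k, coord k x = coord k y) : x = y :=
  Prod.ext (h true) (h false)

section Carpet

variable {N : ℕ}

theorem digit_ext {d e : Fin N × Fin N} (h : ∀ k, digit k d = digit k e) : d = e := by
  have h1 := h true
  have h2 := h false
  simp only [digit, cond_true, cond_false, Nat.cast_inj] at h1 h2
  exact Prod.ext (Fin.ext h1) (Fin.ext h2)

theorem digit_nonneg (k : Bool) (d : Fin N × Fin N) : 0 ≤ digit k d := by
  cases k <;> simp [digit]

theorem digit_lt (k : Bool) (d : Fin N × Fin N) : digit k d < N := by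
  cases k <;> simp [digit]

theorem coord_zoom (k : Bool) (d : Fin N × Fin N) (x : ℝ × ℝ) :
    coord k (zoom d x) = N * coord k x - digit k d := by
  cases k <;> simp [digit, coord, zoom]

theorem base_pos (d : Fin N × Fin N) : (0 : ℝ) < N := by
  exact_mod_cast d.1.pos

theorem coord_gscMap (k : Bool) (d : Fin N × Fin N) (x : ℝ × ℝ) :
    N * coord k (gscMap N d x) = coord k x + digit k d := by
  have := (base_pos d).ne'
  cases k <;> simp [digit, coord, gscMap] <;> field_simp

theorem zoom_gscMap (d : Fin N × Fin N) (x : ℝ × ℝ) : zoom d (gscMap N d x) = x :=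
  coord_ext fun k => by rw [coord_zoom, coord_gscMap]; ring

theorem gscMap_zoom (d : Fin N × Fin N) (x : ℝ × ℝ) : gscMap N d (zoom d x) = x :=
  coord_ext fun k => by
    have := coord_gscMap k d (zoom d x)
    rw [coord_zoom, sub_add_cancel] at this
    exact mul_left_cancel₀ (base_pos d).ne' this

theorem gscMap_injective (d : Fin N × Fin N) : Function.Injective (gscMap N d) :=
  Function.LeftInverse.injective (zoom_gscMap d)

theorem coord_dist_le (k : Bool) (x y : ℝ × ℝ) : |coord k x - coord k y| ≤ dist x y := by
  cases k
  · exact (Real.dist_eq x.2 y.2).symm.trans_le (le_max_right _ _)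
  · exact (Real.dist_eq x.1 y.1).symm.trans_le (le_max_left _ _)

theorem dist_zoom (d : Fin N × Fin N) (x y : ℝ × ℝ) :
    dist (zoom d x) (zoom d y) = N * dist x y := by
  have h := gscMap_dist N d (zoom d x) (zoom d y)
  have := (base_pos d).ne'
  rw [gscMap_zoom, gscMap_zoom] at h
  rw [h]
  field_simp

variable {D : Finset (Fin N × Fin N)}

theorem mem_cell {d : Fin N × Fin N} {x : ℝ × ℝ} : x ∈ cell N D d ↔ zoom d x ∈ gsc N D :=
  ⟨by rintro ⟨y, hy, rfl⟩; rwa [zoom_gscMap], fun h => ⟨_, h, gscMap_zoom d x⟩⟩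

theorem gscMap_mem_cell {d : Fin N × Fin N} {x : ℝ × ℝ} (hx : x ∈ gsc N D) :
    gscMap N d x ∈ cell N D d := ⟨x, hx, rfl⟩

theorem coord_mem {x : ℝ × ℝ} (hx : x ∈ gsc N D) (k : Bool) : 0 ≤ coord k x ∧ coord k x ≤ 1 := by
  have := Set.mem_iInter.1 hx 0
  simp only [gscApprox, Set.mem_prod, Set.mem_Icc] at this
  cases k
  · exact this.2
  · exact this.1

theorem dist_le_one {x y : ℝ × ℝ} (hx : x ∈ gsc N D) (hy : y ∈ gsc N D) : dist x y ≤ 1 := by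
  have key : ∀ k, |coord k x - coord k y| ≤ 1 := fun k => by
    have h1 := coord_mem hx k
    have h2 := coord_mem hy k
    rw [abs_le]; constructor <;> linarith
  exact max_le (Real.dist_eq x.1 y.1 ▸ key true) (Real.dist_eq x.2 y.2 ▸ key false)

theorem cell_subset {d : Fin N × Fin N} (hd : d ∈ D) : cell N D d ⊆ gsc N D := by
  intro x hx
  rw [(gsc_isAttractor N D ⟨d, hd⟩).2.2]
  exact Set.mem_biUnion hd hx

theorem exists_mem_cell (hD : D.Nonempty) {x : ℝ × ℝ} (hx : x ∈ gsc N D) :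
    ∃ d ∈ D, x ∈ cell N D d := by
  rw [(gsc_isAttractor N D hD).2.2] at hx
  simp only [Set.mem_iUnion, exists_prop] at hx
  exact hx

theorem isClosed_cell (hD : D.Nonempty) (d : Fin N × Fin N) : IsClosed (cell N D d) :=
  ((gsc_isAttractor N D hD).2.1.image (gscMap_continuous N d)).isClosed

theorem isConnected_cell (hF : IsConnected (gsc N D)) (d : Fin N × Fin N) :
    IsConnected (cell N D d) :=
  hF.image _ (gscMap_continuous N d).continuousOn

theorem Touch.symm {d e : Fin N × Fin N} (h : Touch N D d e) : Touch N D e d := by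
  unfold Touch at *; rwa [Set.inter_comm]

/-- The two classes give two closed sets covering the connected set `F`, so these have a common
point. -/
theorem linkedIn_digits (hD : D.Nonempty) (hF : IsConnected (gsc N D)) :
    LinkedIn (Touch N D) (D : Set (Fin N × Fin N)) := by
  intro C hC hne hne'
  have hcl : ∀ S : Set (Fin N × Fin N), IsClosed (⋃ d ∈ S, cell N D d) := fun S =>
    S.toFinite.isClosed_biUnion fun d _ => isClosed_cell hD d
  have hnon := hF.nonempty
  obtain ⟨x, -, hx, hx'⟩ := isPreconnected_closed_iff.1 hF.isPreconnected
    (⋃ d ∈ C, cell N D d) (⋃ d ∈ (D : Set (Fin N × Fin N)) \ C, cell N D d) (hcl _) (hcl _)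
    (by
      intro x hx
      obtain ⟨d, hd, hxd⟩ := exists_mem_cell hD hx
      by_cases h : d ∈ C
      · exact Or.inl (Set.mem_biUnion h hxd)
      · exact Or.inr (Set.mem_biUnion (show d ∈ (D : Set _) \ C from ⟨hd, h⟩) hxd))
    (by
      obtain ⟨d, hd⟩ := hne
      obtain ⟨y, hy⟩ := hnon
      exact ⟨_, cell_subset (hC hd) (gscMap_mem_cell hy), Set.mem_biUnion hd (gscMap_mem_cell hy)⟩)
    (by
      obtain ⟨d, hd⟩ := hne'
      obtain ⟨y, hy⟩ := hnon
      exact ⟨_, cell_subset hd.1 (gscMap_mem_cell hy), Set.mem_biUnion hd (gscMap_mem_cell hy)⟩)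
  simp only [Set.mem_iUnion, exists_prop] at hx hx'
  obtain ⟨c, hc, hxc⟩ := hx
  obtain ⟨e, he, hxe⟩ := hx'
  exact ⟨c, hc, e, he, x, hxc, hxe⟩

/-! ### Splits of the second-level words -/

/-- There is no way to split the second-level cells other than `φ_i φ_l(F)` into two classes
without contact, so that both classes contain a full first-level cell or a linked set
`φ_i(F) \ φ_i φ_l(F)`. -/
def NoLargeSplit (N : ℕ) (D : Finset (Fin N × Fin N)) : Prop :=
  ∀ i ∈ D, ∀ l ∈ D, ∀ P : Bool → Fin N × Fin N → Fin N × Fin N → Prop,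
    (∀ a ∈ D, ∀ b ∈ D, ∀ c ∈ D, ∀ e ∈ D, (a, b) ≠ (i, l) → (c, e) ≠ (i, l) →
      P true a b → P false c e →
      Disjoint (gscMap N a '' cell N D b) (gscMap N c '' cell N D e)) →
    (∀ a ∈ D, ∀ b ∈ D, (a, b) ≠ (i, l) → P true a b ∨ P false a b) →
    (∀ s, (∃ h ∈ D, h ≠ i ∧ ∀ d ∈ D, P s h d) ∨
      (LinkedIn (Touch N D) ((D : Set (Fin N × Fin N)) \ {l}) ∧ ∀ d ∈ D, d ≠ l → P s i d)) →
    False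

theorem hataGraph_two_adj {v w : Fin 2 → D} : (hataGraph N D 2).Adj v w ↔ v ≠ w ∧
    (gscMap N (v 0) '' cell N D (v 1) ∩ gscMap N (w 0) '' cell N D (w 1)).Nonempty := by
  have h : ∀ v : Fin 2 → D, gscCell N D 2 v = gscMap N (v 0) '' cell N D (v 1) := by
    intro v
    simp only [gscCell, gscWordMap, cell, Set.image_image, Function.comp, id]
    rfl
  simp only [hataGraph, h]

/-- The words `h d` with `d` in a linked set form a linked set of vertices of `Γ₂`. -/
theorem linkedIn_hataGraph {S : Set (Fin N × Fin N)} (hS : LinkedIn (Touch N D) S)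
    (hSD : S ⊆ D) (h : D) :
    LinkedIn (hataGraph N D 2).Adj {w | w 0 = h ∧ (w 1 : Fin N × Fin N) ∈ S} := by
  intro C hC hne hne'
  obtain ⟨a, ⟨u, hu, rfl⟩, b, ⟨hbS, hb⟩, x, hxa, hxb⟩ :=
    hS ((fun w : Fin 2 → D => (w 1 : Fin N × Fin N)) '' C)
      (by rintro _ ⟨w, hw, rfl⟩; exact (hC hw).2)
      (hne.image _)
      (by
        obtain ⟨w, hw, hwC⟩ := hne'
        refine ⟨w 1, hw.2, ?_⟩
        rintro ⟨w', hw', h'⟩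
        apply hwC
        have : w' = w := by
          ext1 j
          fin_cases j
          · exact (hC hw').1.trans hw.1.symm
          · exact Subtype.ext h'
        rwa [← this])
  have hu0 := (hC hu).1
  have hw : (![h, ⟨b, hSD hbS⟩] : Fin 2 → D) ∉ C := fun hw => hb ⟨_, hw, rfl⟩
  refine ⟨u, hu, ![h, ⟨b, hSD hbS⟩], ⟨⟨rfl, hbS⟩, hw⟩, ?_⟩
  rw [hataGraph_two_adj]
  refine ⟨fun h => hw (h ▸ hu), gscMap N h x, ?_, ?_⟩
  · rw [hu0]; exact ⟨x, hxa, rfl⟩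
  · exact ⟨x, hxb, rfl⟩

theorem ncard_words {S : Set (Fin N × Fin N)} (hSD : S ⊆ D) (h : D) :
    {w : Fin 2 → D | w 0 = h ∧ (w 1 : Fin N × Fin N) ∈ S}.ncard = S.ncard := by
  have : S = (fun w : Fin 2 → D => (w 1 : Fin N × Fin N)) ''
      {w : Fin 2 → D | w 0 = h ∧ (w 1 : Fin N × Fin N) ∈ S} := by
    ext b
    constructor
    · intro hb
      exact ⟨![h, ⟨b, hSD hb⟩], ⟨rfl, hb⟩, rfl⟩
    · rintro ⟨w, hw, rfl⟩
      exact hw.2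
  conv_rhs => rw [this]
  refine (Set.InjOn.ncard_image ?_).symm
  intro w hw w' hw' h'
  ext1 j
  fin_cases j
  · exact hw.1.trans hw'.1.symm
  · exact Subtype.ext h'

/-- The words `h d` number `|D|`, the words `i d` with `d ≠ l` number `|D| - 1`. Being linked, each
such set lies in one component of `Γ₂ - il`; one on each side makes the second component too large.
-/
theorem noLargeSplit_of_chi_lt (hD : 1 < D.card) (hF : IsConnected (gsc N D))
    (hchi : chi (hataGraph N D 2) < D.card - 1) : NoLargeSplit N D := by
  intro i hi l hl P hdisj hcov hbig
  have hDne : D.Nonempty := Finset.card_pos.1 (by omega)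
  set v : Fin 2 → D := ![⟨i, hi⟩, ⟨l, hl⟩] with hv
  have hvne : ∀ w : Fin 2 → D, w ≠ v → ((w 0 : Fin N × Fin N), (w 1 : Fin N × Fin N)) ≠ (i, l) := by
    intro w hw h
    apply hw
    rw [Prod.mk.injEq] at h
    ext1 j
    fin_cases j
    · exact Subtype.ext h.1
    · exact Subtype.ext h.2
  have hset : ∀ s, ∃ U : Set (Fin 2 → D), v ∉ U ∧ LinkedIn (hataGraph N D 2).Adj U ∧
      (∀ w ∈ U, P s (w 0) (w 1)) ∧ D.card - 1 ≤ U.ncard := by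
    intro s
    rcases hbig s with ⟨h, hh, hne, hP⟩ | ⟨hlink, hP⟩
    · refine ⟨_, ?_, linkedIn_hataGraph (linkedIn_digits hDne hF) le_rfl ⟨h, hh⟩, ?_, ?_⟩
      · intro hvU
        exact hne (congrArg Subtype.val hvU.1).symm
      · intro w hw
        rw [hw.1]
        exact hP _ (w 1).2
      · rw [ncard_words le_rfl, Set.ncard_coe_finset]
        omega
    · refine ⟨_, ?_, linkedIn_hataGraph hlink Set.sdiff_subset ⟨i, hi⟩, ?_, ?_⟩
      · intro hvU
        exact hvU.2.2 rfl
      · intro w hw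
        rw [hw.1]
        exact hP _ (w 1).2 hw.2.2
      · rw [ncard_words Set.sdiff_subset, Set.ncard_sdiff_singleton_of_mem hl,
          Set.ncard_coe_finset]
  obtain ⟨U₁, hvU₁, hl₁, hP₁, hc₁⟩ := hset true
  obtain ⟨U₂, hvU₂, hl₂, hP₂, hc₂⟩ := hset false
  have hdis : ∀ a b : Fin 2 → D, a ≠ v → b ≠ v → P true (a 0) (a 1) → P false (b 0) (b 1) →
      ¬ (gscMap N (a 0) '' cell N D (a 1) ∩ gscMap N (b 0) '' cell N D (b 1)).Nonempty := by
    intro a b ha hb hPa hPb h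
    exact h.ne_empty (hdisj _ (a 0).2 _ (a 1).2 _ (b 0).2 _ (b 1).2 (hvne a ha) (hvne b hb)
      hPa hPb).inter_eq
  have hnonempty : ∀ w : Fin 2 → D, (gscMap N (w 0) '' cell N D (w 1)).Nonempty := fun w =>
    (isConnected_cell hF _).nonempty.image _
  have := le_chi_of_split (hataGraph N D 2) v (fun w => P true (w 0) (w 1))
    (fun a b ha hb hPa hPb hadj => by
      rcases hcov _ (b 0).2 _ (b 1).2 (hvne b hb) with h | h
      · exact hPb h
      · exact hdis a b ha hb hPa h (hataGraph_two_adj.1 hadj).2)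
    -- `P true` and `P false` are not assumed exclusive; a word satisfying both would have a cell
    -- disjoint from itself.
    hvU₁ hvU₂ hl₁ hl₂ hP₁ (fun w hw h => by
      have hne : w ≠ v := fun h => hvU₂ (h ▸ hw)
      exact hdis w w hne hne h (hP₂ w hw) (by rw [Set.inter_self]; exact hnonempty w))
    (by omega : 0 < D.card - 1) hc₁ hc₂
  omega

/-! ### Periodic points and contacts of two cells -/

/-- The fixed point `d / (N - 1)` of `φ_d`. -/
noncomputable def fixedPt (d : Fin N × Fin N) : ℝ × ℝ :=
  (((d.1 : ℕ) : ℝ) / ((N : ℝ) - 1), ((d.2 : ℕ) : ℝ) / ((N : ℝ) - 1))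

theorem coord_fixedPt (k : Bool) (d : Fin N × Fin N) :
    coord k (fixedPt d) = digit k d / ((N : ℝ) - 1) := by
  cases k <;> simp [coord, digit, fixedPt]

theorem base_sub_one_pos (hN : 2 ≤ N) : (0 : ℝ) < (N : ℝ) - 1 := by
  have : (2 : ℝ) ≤ N := by exact_mod_cast hN
  linarith

theorem zoom_fixedPt (hN : 2 ≤ N) (d : Fin N × Fin N) : zoom d (fixedPt d) = fixedPt d :=
  coord_ext fun k => by
    have := (base_sub_one_pos hN).ne'
    rw [coord_zoom, coord_fixedPt]
    field_simp
    ring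

theorem digit_le_sub_one (k : Bool) (d : Fin N × Fin N) : (digit k d : ℝ) ≤ N - 1 := by
  have : digit k d + 1 ≤ (N : ℤ) := digit_lt k d
  have : (digit k d : ℝ) + 1 ≤ N := by exact_mod_cast this
  linarith

theorem fixedPt_mem (hN : 2 ≤ N) {d : Fin N × Fin N} (hd : d ∈ D) : fixedPt d ∈ gsc N D := by
  refine Set.mem_iInter.2 fun n => ?_
  induction n with
  | zero =>
    have h := base_sub_one_pos hN
    have key : ∀ k, coord k (fixedPt d) ∈ Set.Icc (0 : ℝ) 1 := fun k => by
      rw [coord_fixedPt]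
      have h0 : (0 : ℝ) ≤ digit k d := by exact_mod_cast digit_nonneg k d
      exact ⟨div_nonneg h0 h.le, (div_le_one h).2 (digit_le_sub_one k d)⟩
    exact ⟨key true, key false⟩
  | succ n ih =>
    refine Set.mem_biUnion hd ⟨fixedPt d, ih, ?_⟩
    conv_lhs => rw [← zoom_fixedPt hN d]
    exact gscMap_zoom d _

/-- With `q = c / (N - 1)` in a coordinate, `N q - e = q + (c - e)` must lie in `[0,1]`. For `e ≠ c`
this forces `q = 0` with `c > 0` or `q = 1` with `c < N - 1`, both impossible. -/
theorem eq_of_fixedPt_mem_cell (hN : 2 ≤ N) {c e : Fin N × Fin N}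
    (h : fixedPt c ∈ cell N D e) : e = c := by
  refine digit_ext fun k => ?_
  have hm := coord_mem (mem_cell.1 h) k
  have hn := base_sub_one_pos hN
  have hz := congrArg (coord k) (zoom_fixedPt hN c)
  rw [coord_zoom] at hz hm
  have hz' : (N : ℝ) * coord k (fixedPt c) = digit k c + coord k (fixedPt c) := by linarith
  rw [hz', coord_fixedPt] at hm
  have hc0 := digit_nonneg k c
  have heN := digit_lt k e
  have he0 := digit_nonneg k e
  have hcN := digit_le_sub_one k c
  have hc0' : (0 : ℝ) ≤ digit k c := by exact_mod_cast hc0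
  obtain ⟨h1, h2⟩ := hm
  have hq0 : (0 : ℝ) ≤ digit k c / ((N : ℝ) - 1) := div_nonneg hc0' hn.le
  have hq1 : digit k c / ((N : ℝ) - 1) ≤ 1 := (div_le_one hn).2 hcN
  rcases lt_trichotomy (digit k e) (digit k c) with hlt | heq | hgt
  · have : (digit k e : ℝ) + 1 ≤ digit k c := by exact_mod_cast hlt
    have hq : (digit k c : ℝ) / ((N : ℝ) - 1) = 0 := by linarith
    rw [div_eq_zero_iff] at hq
    rcases hq with hq | hq
    · have : digit k c = 0 := by exact_mod_cast hq
      omega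
    · exact absurd hq hn.ne'
  · exact heq
  · have : (digit k c : ℝ) + 1 ≤ digit k e := by exact_mod_cast hgt
    have hq : (digit k c : ℝ) / ((N : ℝ) - 1) = 1 := by linarith
    rw [div_eq_one_iff_eq hn.ne'] at hq
    have : (digit k c : ℝ) + 1 = N := by linarith
    have : digit k c + 1 = N := by exact_mod_cast this
    omega

theorem digit_sub_le_one {d e : Fin N × Fin N} {x : ℝ × ℝ} (hd : x ∈ cell N D d)
    (he : x ∈ cell N D e) (k : Bool) : digit k d - digit k e ≤ 1 := by
  have h1 := coord_mem (mem_cell.1 hd) k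
  have h2 := coord_mem (mem_cell.1 he) k
  rw [coord_zoom] at h1 h2
  have : (digit k d : ℝ) - digit k e ≤ 1 := by linarith [h1.1, h2.2]
  exact_mod_cast this

theorem Touch.digit_sub_le_one {d e : Fin N × Fin N} (h : Touch N D d e) (k : Bool) :
    digit k d - digit k e ≤ 1 :=
  let ⟨_, hd, he⟩ := h
  _root_.digit_sub_le_one hd he k

/-- The contact of two points `u = v + δ`, with `δ` an integer, on the unit interval: either the
contact persists one level deeper, or it takes place at a subdivision point. -/
theorem contact_interval {u v : ℝ} {δ c c' : ℤ} {N : ℕ} (hu : 0 ≤ u ∧ u ≤ 1)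
    (hv : 0 ≤ v ∧ v ≤ 1) (hc : 0 ≤ c) (hcN : c < N) (hc' : 0 ≤ c') (hcN' : c' < N)
    (hu' : 0 ≤ N * u - c ∧ N * u - c ≤ 1) (hv' : 0 ≤ N * v - c' ∧ N * v - c' ≤ 1)
    (h : u - v = δ) :
    (c - c' = (N - 1) * δ ∨ δ = 0 ∧ ∃ m : ℤ, N * u = m) ∧ (δ ≠ 0 → ∃ m : ℤ, N * u = m) := by
  have h1 : δ ≤ 1 := by
    have : (δ : ℝ) ≤ 1 := by linarith [hu.2, hv.1]
    exact_mod_cast this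
  have h2 : -1 ≤ δ := by
    have : (-1 : ℝ) ≤ δ := by linarith [hu.1, hv.2]
    exact_mod_cast this
  -- For `δ = ±1` the points are opposite endpoints of the interval, whose digits are forced to be
  -- `0` and `N - 1`.
  obtain rfl | rfl | rfl : δ = -1 ∨ δ = 0 ∨ δ = 1 := by omega
  · push_cast at h
    obtain rfl : u = 0 := by linarith [hu.1, hv.2]
    obtain rfl : v = 1 := by linarith
    have e1 : c = 0 := by
      have : (c : ℝ) ≤ 0 := by linarith [hu'.1]
      have : c ≤ 0 := by exact_mod_cast this
      omega
    have e2 : c' = N - 1 := by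
      have : (N : ℝ) ≤ c' + 1 := by linarith [hv'.2]
      have : (N : ℤ) ≤ c' + 1 := by exact_mod_cast this
      omega
    exact ⟨Or.inl (by rw [e1, e2]; ring), fun _ => ⟨0, by simp⟩⟩
  · push_cast at h
    obtain rfl : u = v := by linarith
    refine ⟨?_, fun h => absurd rfl h⟩
    have h3 : c - c' ≤ 1 := by
      have : (c : ℝ) - c' ≤ 1 := by linarith [hu'.1, hv'.2]
      exact_mod_cast this
    have h4 : c' - c ≤ 1 := by
      have : (c' : ℝ) - c ≤ 1 := by linarith [hu'.2, hv'.1]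
      exact_mod_cast this
    obtain h5 | h5 | h5 : c = c' ∨ c = c' + 1 ∨ c' = c + 1 := by omega
    · left; rw [h5]; ring
    · right
      refine ⟨rfl, c, ?_⟩
      have : (c : ℝ) = c' + 1 := by exact_mod_cast h5
      linarith [hu'.1, hv'.2]
    · right
      refine ⟨rfl, c', ?_⟩
      have : (c' : ℝ) = c + 1 := by exact_mod_cast h5
      linarith [hu'.2, hv'.1]
  · push_cast at h
    obtain rfl : u = 1 := by linarith [hu.2, hv.1]
    obtain rfl : v = 0 := by linarith
    have e1 : c' = 0 := by
      have : (c' : ℝ) ≤ 0 := by linarith [hv'.1]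
      have : c' ≤ 0 := by exact_mod_cast this
      omega
    have e2 : c = N - 1 := by
      have : (N : ℝ) ≤ c + 1 := by linarith [hu'.2]
      have : (N : ℤ) ≤ c + 1 := by exact_mod_cast this
      omega
    exact ⟨Or.inl (by rw [e1, e2]; ring), fun _ => ⟨N, by simp⟩⟩

theorem coord_zoom_sub_coord_zoom (d e : Fin N × Fin N) (x : ℝ × ℝ) (k : Bool) :
    coord k (zoom d x) - coord k (zoom e x) = ((digit k e - digit k d : ℤ) : ℝ) := by
  rw [coord_zoom, coord_zoom]; push_cast; ring

theorem contact_coord {d e c c' : Fin N × Fin N} {x : ℝ × ℝ} (hd : x ∈ cell N D d)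
    (he : x ∈ cell N D e) (hc : zoom d x ∈ cell N D c) (hc' : zoom e x ∈ cell N D c')
    (k : Bool) :
    (digit k c - digit k c' = (N - 1) * (digit k e - digit k d) ∨
      digit k e - digit k d = 0 ∧ ∃ m : ℤ, N * coord k (zoom d x) = m) ∧
    (digit k e - digit k d ≠ 0 → ∃ m : ℤ, N * coord k (zoom d x) = m) := by
  have h1 := coord_mem (mem_cell.1 hc) k
  have h2 := coord_mem (mem_cell.1 hc') k
  rw [coord_zoom] at h1 h2
  exact contact_interval (coord_mem (mem_cell.1 hd) k) (coord_mem (mem_cell.1 he) k)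
    (digit_nonneg k c) (digit_lt k c) (digit_nonneg k c') (digit_lt k c') h1 h2
    (coord_zoom_sub_coord_zoom d e x k)

theorem zoom_gscMap_eq {d e : Fin N × Fin N} {a b : ℝ × ℝ}
    (h : ∀ k, coord k a - coord k b = ((digit k e - digit k d : ℤ) : ℝ)) :
    zoom e (gscMap N d a) = b :=
  coord_ext fun k => by
    have := h k
    push_cast at this
    rw [coord_zoom, coord_gscMap]
    linarith

/-- The digit condition says that the fixed points of `c` and `c'` differ by exactly `e - d`. -/
theorem gscMap_fixedPt_mem (hN : 2 ≤ N) {d e c c' : Fin N × Fin N} (hc' : c' ∈ D)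
    (h : ∀ k, digit k c - digit k c' = (N - 1) * (digit k e - digit k d)) :
    gscMap N d (fixedPt c) ∈ cell N D e := by
  rw [mem_cell, zoom_gscMap_eq (b := fixedPt c')]
  · exact fixedPt_mem hN hc'
  · intro k
    have hk : (digit k c : ℝ) - digit k c' = (N - 1) * (digit k e - digit k d) := by
      exact_mod_cast h k
    have := (base_sub_one_pos hN).ne'
    rw [coord_fixedPt, coord_fixedPt, ← sub_div, hk]
    push_cast
    field_simp

/-- Either two touching cells meet in a point with purely periodic code, or each of their common
points is a vertex of the second-level grid. -/
theorem contact_dichotomy (hN : 2 ≤ N) {d e : Fin N × Fin N} (hne : d ≠ e) {x : ℝ × ℝ}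
    (hd : x ∈ cell N D d) (he : x ∈ cell N D e) (hD : D.Nonempty) :
    (∃ c ∈ D, gscMap N d (fixedPt c) ∈ cell N D e) ∨
      ∀ k, ∃ m : ℤ, N * coord k (zoom d x) = m := by
  obtain ⟨c, hcD, hc⟩ := exists_mem_cell hD (mem_cell.1 hd)
  obtain ⟨c', hcD', hc'⟩ := exists_mem_cell hD (mem_cell.1 he)
  have key := contact_coord hd he hc hc'
  by_cases hall : ∀ k, digit k c - digit k c' = (N - 1) * (digit k e - digit k d)
  · exact Or.inl ⟨c, hcD, gscMap_fixedPt_mem hN hcD' hall⟩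
  · right
    push Not at hall
    obtain ⟨k, hk⟩ := hall
    obtain ⟨hk0, hkm⟩ := (key k).1.resolve_left hk
    have hk' : digit (!k) e - digit (!k) d ≠ 0 := by
      intro h0
      apply hne
      apply digit_ext
      intro k'
      rcases Bool.eq_or_eq_not k' k with rfl | rfl <;> omega
    intro k'
    rcases Bool.eq_or_eq_not k' k with rfl | rfl
    · exact hkm
    · exact (key _).2 hk'

/-- If two cells meet in a single point, then this point has a unique second-level code. -/
theorem code_unique_of_single_contact (hN : 2 ≤ N) {d e : Fin N × Fin N} (hne : d ≠ e)
    {p : ℝ × ℝ} (hd : p ∈ cell N D d) (he : p ∈ cell N D e)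
    (hp : ∀ x ∈ cell N D d, x ∈ cell N D e → x = p) {c b : Fin N × Fin N} (hcD : c ∈ D)
    (hbD : b ∈ D) (hc : zoom d p ∈ cell N D c) (hb : zoom d p ∈ cell N D b) : c = b := by
  obtain ⟨c', hcD', hc'⟩ := exists_mem_cell ⟨c, hcD⟩ (mem_cell.1 he)
  have hfix : ∀ a ∈ D, (∀ k, digit k a - digit k c' = (N - 1) * (digit k e - digit k d)) →
      zoom d p = fixedPt a := by
    intro a haD ha
    rw [← hp _ (gscMap_mem_cell (fixedPt_mem hN haD)) (gscMap_fixedPt_mem hN hcD' ha), zoom_gscMap]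
  -- If the digit pair reproduces the offset of the cells, `p` rescales to a fixed point, whose
  -- digit is unique.
  by_cases h1 : ∀ k, digit k c - digit k c' = (N - 1) * (digit k e - digit k d)
  · rw [hfix c hcD h1] at hb
    exact (eq_of_fixedPt_mem_cell hN hb).symm
  by_cases h2 : ∀ k, digit k b - digit k c' = (N - 1) * (digit k e - digit k d)
  · rw [hfix b hbD h2] at hc
    exact eq_of_fixedPt_mem_cell hN hc
  push Not at h1 h2
  obtain ⟨k, hk⟩ := h1
  obtain ⟨k', hk'⟩ := h2
  have hk0 := ((contact_coord hd he hc hc' k).1.resolve_left hk).1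
  have hk0' := ((contact_coord hd he hb hc' k').1.resolve_left hk').1
  have hδ : digit (!k) e - digit (!k) d ≠ 0 := by
    intro h0
    apply hne
    apply digit_ext
    intro k'
    rcases Bool.eq_or_eq_not k' k with rfl | rfl <;> omega
  obtain rfl : k' = k := by
    rcases Bool.eq_or_eq_not k' k with rfl | rfl
    · rfl
    · exact absurd hk0' hδ
  apply digit_ext
  intro j
  rcases Bool.eq_or_eq_not j k' with rfl | rfl
  · rw [hk0, mul_zero, sub_ne_zero] at hk hk'
    have hz : coord j (zoom d p) = coord j (zoom e p) := by
      have := coord_zoom_sub_coord_zoom d e p j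
      rw [hk0] at this
      push_cast at this
      linarith
    have a1 := coord_mem (mem_cell.1 hc) j
    have a2 := coord_mem (mem_cell.1 hb) j
    have a3 := coord_mem (mem_cell.1 hc') j
    rw [coord_zoom] at a1 a2 a3
    rw [← hz] at a3
    -- Along `j` the digits of `c`, `b`, `c'` are pairwise at most one apart and `c'` differs from
    -- the other two, so these agree.
    have b1 := digit_sub_le_one hc hb j
    have b2 := digit_sub_le_one hb hc j
    have cast : ∀ m n : ℤ, (m : ℝ) - n ≤ 1 → m - n ≤ 1 := fun m n h => by exact_mod_cast h
    have b3 := cast (digit j c) (digit j c') (by linarith [a1.1, a3.2])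
    have b4 := cast (digit j c') (digit j c) (by linarith [a3.1, a1.2])
    have b5 := cast (digit j b) (digit j c') (by linarith [a2.1, a3.2])
    have b6 := cast (digit j c') (digit j b) (by linarith [a3.1, a2.2])
    omega
  · have e1 := (contact_coord hd he hc hc' (!k')).1.resolve_right fun h => hδ h.1
    have e2 := (contact_coord hd he hb hc' (!k')).1.resolve_right fun h => hδ h.1
    omega

/-! ### Fragile points -/

/-- The digits split into two non-empty classes `C true` and `C false` whose cells have no common
point other than `p`. -/
structure IsFragileAt (N : ℕ) (D : Finset (Fin N × Fin N)) (p : ℝ × ℝ)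
    (C : Bool → Set (Fin N × Fin N)) : Prop where
  sub : ∀ s, C s ⊆ D
  cover : ∀ d ∈ D, ∃ s, d ∈ C s
  disj : ∀ s, ∀ d ∈ C s, d ∉ C (!s)
  nonempty : ∀ s, (C s).Nonempty
  single : ∀ s, ∀ c ∈ C s, ∀ e ∈ C (!s), ∀ x ∈ cell N D c, x ∈ cell N D e → x = p

theorem IsFragileAt.of_set {p : ℝ × ℝ} {E : Set (Fin N × Fin N)} (hE : E ⊆ D)
    (hne : E.Nonempty) (hne' : ((D : Set (Fin N × Fin N)) \ E).Nonempty)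
    (h : ∀ c ∈ E, ∀ e ∈ D, e ∉ E → ∀ x ∈ cell N D c, x ∈ cell N D e → x = p) :
    IsFragileAt N D p (fun s => cond s E ((D : Set (Fin N × Fin N)) \ E)) where
  sub s := by cases s; exacts [Set.sdiff_subset, hE]
  cover d hd := by
    by_cases hdE : d ∈ E
    · exact ⟨true, hdE⟩
    · exact ⟨false, hd, hdE⟩
  disj s d hd := by
    cases s
    · exact hd.2
    · exact fun h' => h'.2 hd
  nonempty s := by cases s; exacts [hne', hne]
  single s c hc e he x hxc hxe := by
    cases s
    · exact h e he c hc.1 hc.2 x hxe hxc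
    · exact h c hc e he.1 he.2 x hxc hxe

/-- Connectedness forces the two classes to touch, which they can do only at `p`. -/
theorem IsFragileAt.exists_mem {p : ℝ × ℝ} {C : Bool → Set (Fin N × Fin N)}
    (hF : IsConnected (gsc N D)) (h : IsFragileAt N D p C) (s : Bool) :
    ∃ c ∈ C s, p ∈ cell N D c := by
  have hD : D.Nonempty := (h.nonempty s).mono (h.sub s)
  obtain ⟨c, hc, e, he, x, hxc, hxe⟩ := linkedIn_digits hD hF (C s) (h.sub s) (h.nonempty s)
    ((h.nonempty (!s)).mono fun d hd =>
      ⟨h.sub _ hd, fun hd' => h.disj s d hd' hd⟩)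
  obtain ⟨s', hs'⟩ := h.cover e he.1
  have : s' = !s := by
    rcases Bool.eq_or_eq_not s' s with rfl | h'
    · exact absurd hs' he.2
    · exact h'
  subst this
  exact ⟨c, hc, h.single s c hc e hs' x hxc hxe ▸ hxc⟩

/-- All contact between the classes passes through the word `il`. A second digit in the class of
`i`, or linkedness of `D \ {l}`, would make that side large; the other side contains the full cell
`j`. -/
theorem IsFragileAt.of_unique (hN : 2 ≤ N) (hF : IsConnected (gsc N D)) (hS : NoLargeSplit N D)
    {p : ℝ × ℝ} {C : Bool → Set (Fin N × Fin N)} (h : IsFragileAt N D p C) {s : Bool}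
    {i : Fin N × Fin N} (hi : i ∈ C s) (hpi : p ∈ cell N D i)
    (huniq : ∀ d ∈ C s, p ∈ cell N D d → d = i) {l : Fin N × Fin N} (hl : l ∈ D)
    (hpl : zoom i p ∈ cell N D l) :
    (∀ d ∈ C s, d = i) ∧ ¬ LinkedIn (Touch N D) ((D : Set (Fin N × Fin N)) \ {l}) := by
  obtain ⟨j, hj, hpj⟩ := h.exists_mem hF (!s)
  have hcode : ∀ b ∈ D, zoom i p ∈ cell N D b → b = l := fun b hb hpb =>
    code_unique_of_single_contact (d := i) (e := j) hN (fun hij => h.disj s i hi (hij ▸ hj)) hpi hpj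
      (h.single s i hi j hj) hb hl hpb hpl
  have hword : ∀ a ∈ C s, ∀ b ∈ D, p ∈ gscMap N a '' cell N D b → (a, b) = (i, l) := by
    rintro a ha b hb ⟨y, hy, rfl⟩
    obtain rfl := huniq a ha (gscMap_mem_cell (cell_subset hb hy))
    rw [zoom_gscMap] at hcode
    rw [hcode b hb hy]
  have hcell : ∀ a, ∀ b ∈ D, gscMap N a '' cell N D b ⊆ cell N D a := fun a b hb =>
    Set.image_mono (cell_subset hb)
  by_contra hcon
  refine hS i (h.sub s hi) l hl (fun s a _ => a ∈ C s) ?_ ?_ ?_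
  · intro a _ b hb c _ e he hab hce ha hc
    rw [Set.disjoint_left]
    intro x hxa hxc
    have hxp := h.single true a ha c hc x (hcell a b hb hxa) (hcell c e he hxc)
    subst hxp
    cases s
    · exact hce (hword c hc e he hxc)
    · exact hab (hword a ha b hb hxa)
  · intro a ha _ _ _
    obtain ⟨t, ht⟩ := h.cover a ha
    cases t
    · exact Or.inr ht
    · exact Or.inl ht
  · intro t
    rcases Bool.eq_or_eq_not t s with rfl | rfl
    · rw [not_and_or, not_not] at hcon
      rcases hcon with hcon | hcon
      · push Not at hcon
        obtain ⟨d, hd, hdi⟩ := hcon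
        exact Or.inl ⟨d, h.sub _ hd, hdi, fun _ _ => hd⟩
      · exact Or.inr ⟨hcon, fun _ _ _ => hi⟩
    · exact Or.inl ⟨j, h.sub _ hj, fun hij => h.disj s i hi (hij ▸ hj), fun _ _ => hj⟩

/-- Both classes reduce to one digit, so `D \ {l}` is a single digit and trivially linked. -/
theorem IsFragileAt.false_of_unique (hN : 2 ≤ N) (hF : IsConnected (gsc N D))
    (hS : NoLargeSplit N D) {p : ℝ × ℝ} {C : Bool → Set (Fin N × Fin N)}
    (h : IsFragileAt N D p C)
    (huniq : ∀ s, ∃ i ∈ C s, p ∈ cell N D i ∧ ∀ d ∈ C s, p ∈ cell N D d → d = i) : False := by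
  choose f hf hp hu using huniq
  have hD : D.Nonempty := ⟨_, h.sub _ (hf true)⟩
  have hall : ∀ s, ∀ d ∈ C s, d = f s := by
    intro s
    obtain ⟨l, hl, hpl⟩ := exists_mem_cell hD (mem_cell.1 (hp s))
    exact (h.of_unique hN hF hS (hf s) (hp s) (hu s) hl hpl).1
  obtain ⟨l, hl, hpl⟩ := exists_mem_cell hD (mem_cell.1 (hp true))
  refine (h.of_unique hN hF hS (hf true) (hp true) (hu true) hl hpl).2 ?_
  have hmem : ∀ d ∈ D, d = f true ∨ d = f false := by
    intro d hd
    obtain ⟨s, hs⟩ := h.cover d hd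
    cases s
    · exact Or.inr (hall _ d hs)
    · exact Or.inl (hall _ d hs)
  rintro E hE ⟨a, ha⟩ ⟨b, hb, hbE⟩
  have hab : a ≠ b := fun h => hbE (h ▸ ha)
  have hal := (hE ha).2
  have hbl := hb.2
  simp only [Set.mem_singleton_iff] at hal hbl
  rcases hmem a (hE ha).1 with h1 | h1 <;> rcases hmem b hb.1 with h2 | h2 <;>
    rcases hmem l hl with h3 | h3 <;> simp_all

/-- If four cells meet in a point, two adjacent cells among them meet in a second point. -/
theorem exists_second_contact {i j a b : Fin N × Fin N} {p : ℝ × ℝ} {k : Bool}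
    (hpa : p ∈ cell N D a) (hpb : p ∈ cell N D b) (hij : digit (!k) i = digit (!k) j)
    (hab : digit (!k) a = digit (!k) b) (hai : digit (!k) a ≠ digit (!k) i)
    (hka : digit k a = digit k i) (hkb : digit k b = digit k j) :
    ∃ x ∈ cell N D i, x ∈ cell N D j ∧ x ≠ p := by
  -- Since `b - a = j - i`, the contact of `a` and `b` is carried to one of `i` and `j` by the
  -- translation by `(i - a) / N`.
  refine ⟨gscMap N i (zoom a p), gscMap_mem_cell (mem_cell.1 hpa), ?_, ?_⟩
  · rw [mem_cell, zoom_gscMap_eq (b := zoom b p)]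
    · exact mem_cell.1 hpb
    · intro k'
      rw [coord_zoom_sub_coord_zoom]
      rcases Bool.eq_or_eq_not k' k with rfl | rfl
      · rw [hka, hkb]
      · rw [hij, hab]; simp
  · intro hx
    apply hai
    have h := congrArg (fun x => coord (!k) (zoom i x)) hx
    simp only [zoom_gscMap, coord_zoom] at h
    have : (digit (!k) a : ℝ) = digit (!k) i := by linarith
    exact_mod_cast this

/-- The digit of a corner of the unit square is the corresponding corner digit. -/
theorem corner_digit {x u : ℝ × ℝ} {i j l : Fin N × Fin N} {k : Bool} (hi : x ∈ cell N D i)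
    (hj : x ∈ cell N D j) (hij : digit k i ≠ digit k j) (hu : zoom i x = u)
    (hl : u ∈ cell N D l) :
    digit k l = 0 ∨ digit k l = N - 1 := by
  have h1 := coord_mem (mem_cell.1 hi) k
  have h2 := coord_mem (mem_cell.1 hj) k
  have h3 := coord_mem (mem_cell.1 hl) k
  have h4 := digit_sub_le_one hi hj k
  have h5 := digit_sub_le_one hj hi k
  have h6 := digit_nonneg k l
  have h7 := digit_lt k l
  rw [coord_zoom] at h3
  rw [hu] at h1
  have h8 := coord_zoom_sub_coord_zoom i j x k
  rw [hu] at h8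
  obtain h | h : digit k j - digit k i = 1 ∨ digit k j - digit k i = -1 := by omega
  · rw [h] at h8
    push_cast at h8
    have hu1 : coord k u = 1 := by linarith [h1.2, h2.1]
    rw [hu1] at h3
    have : (N : ℝ) ≤ digit k l + 1 := by linarith [h3.2]
    have : (N : ℤ) ≤ digit k l + 1 := by exact_mod_cast this
    omega
  · rw [h] at h8
    push_cast at h8
    have hu1 : coord k u = 0 := by linarith [h1.1, h2.2]
    rw [hu1] at h3
    have : (digit k l : ℝ) ≤ 0 := by linarith [h3.1]
    have : digit k l ≤ 0 := by exact_mod_cast this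
    omega

/-- Cells with a common point lie in a block of two by two squares, where only one square is
diagonally opposite to a given one. -/
theorem exists_edge_adjacent {i j₁ j₂ : Fin N × Fin N} {p : ℝ × ℝ} (hi : p ∈ cell N D i)
    (h₁ : p ∈ cell N D j₁) (h₂ : p ∈ cell N D j₂) (h : j₁ ≠ j₂) :
    (∃ k, digit (!k) i = digit (!k) j₁) ∨ ∃ k, digit (!k) i = digit (!k) j₂ := by
  by_contra hcon
  push Not at hcon
  refine h (digit_ext fun k => ?_)
  have c1 := hcon.1 (!k)
  have c2 := hcon.2 (!k)
  rw [Bool.not_not] at c1 c2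
  have := digit_sub_le_one hi h₁ k
  have := digit_sub_le_one h₁ hi k
  have := digit_sub_le_one hi h₂ k
  have := digit_sub_le_one h₂ hi k
  have := digit_sub_le_one h₁ h₂ k
  have := digit_sub_le_one h₂ h₁ k
  omega

theorem digit_eq_of_three {a b c : Fin N × Fin N} {p : ℝ × ℝ} (ha : p ∈ cell N D a)
    (hb : p ∈ cell N D b) (hc : p ∈ cell N D c) {k : Bool} (h : digit k a ≠ digit k b) :
    digit k c = digit k a ∨ digit k c = digit k b := by
  have := digit_sub_le_one ha hb k
  have := digit_sub_le_one hb ha k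
  have := digit_sub_le_one ha hc k
  have := digit_sub_le_one hc ha k
  have := digit_sub_le_one hb hc k
  have := digit_sub_le_one hc hb k
  omega

/-- A corner cell `l` whose removal disconnects the first-level cells, when all contacts in the
direction `± e_k` are single points: then the carpet is fragile at a point where only two cells
meet. -/
theorem false_of_corner_not_linked (hN : 2 ≤ N) (hF : IsConnected (gsc N D))
    (hS : NoLargeSplit N D) {i j l : Fin N × Fin N} {p : ℝ × ℝ} {k : Bool}
    (hpi : p ∈ cell N D i) (hpj : p ∈ cell N D j)
    (hsingle : ∀ x ∈ cell N D i, x ∈ cell N D j → x = p)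
    (hkij : digit k i ≠ digit k j) (hkij' : digit (!k) i = digit (!k) j)
    (hlD : l ∈ D) (hl : ∀ k, digit k l = 0 ∨ digit k l = N - 1)
    (hlink : ¬ LinkedIn (Touch N D) ((D : Set (Fin N × Fin N)) \ {l})) : False := by
  have hDne : D.Nonempty := ⟨l, hlD⟩
  have htouch : ∀ d e : Fin N × Fin N,
      (∀ k, digit k e - digit k d = digit k j - digit k i) →
      gscMap N d (zoom i p) ∈ cell N D d ∧ gscMap N d (zoom i p) ∈ cell N D e := by
    intro d e h
    refine ⟨gscMap_mem_cell (mem_cell.1 hpi), ?_⟩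
    rw [mem_cell, zoom_gscMap_eq (b := zoom j p)]
    · exact mem_cell.1 hpj
    · intro k
      rw [coord_zoom_sub_coord_zoom, h]
  have honly : ∀ d e : Fin N × Fin N,
      (∀ k, digit k e - digit k d = digit k j - digit k i) →
      ∀ x ∈ cell N D d, x ∈ cell N D e → x = gscMap N d (zoom i p) := by
    intro d e h x hxd hxe
    have hx : gscMap N i (zoom d x) = p := by
      apply hsingle _ (gscMap_mem_cell (mem_cell.1 hxd))
      rw [mem_cell, zoom_gscMap_eq (b := zoom e x)]
      · exact mem_cell.1 hxe
      · intro k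
        rw [coord_zoom_sub_coord_zoom, h]
    rw [← hx, zoom_gscMap, gscMap_zoom]
  have hij1 := digit_sub_le_one hpi hpj k
  have hij2 := digit_sub_le_one hpj hpi k
  -- cells differing by one step in direction `k` touch in a single point
  have hstep : ∀ d e : Fin N × Fin N, digit (!k) d = digit (!k) e → digit k d ≠ digit k e →
      digit k d - digit k e ≤ 1 → digit k e - digit k d ≤ 1 →
      ∃ z, z ∈ cell N D d ∧ z ∈ cell N D e ∧
        ∀ x ∈ cell N D d, x ∈ cell N D e → x = z := by
    intro d e h0 h1 h2 h3
    by_cases hs : digit k e - digit k d = digit k j - digit k i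
    · have hall : ∀ k, digit k e - digit k d = digit k j - digit k i := by
        intro k'
        rcases Bool.eq_or_eq_not k' k with rfl | rfl
        · exact hs
        · omega
      exact ⟨_, (htouch d e hall).1, (htouch d e hall).2, honly d e hall⟩
    · have hall : ∀ k, digit k d - digit k e = digit k j - digit k i := by
        intro k'
        rcases Bool.eq_or_eq_not k' k with rfl | rfl
        · omega
        · omega
      exact ⟨_, (htouch e d hall).2, (htouch e d hall).1, fun x hx hx' => honly e d hall x hx' hx⟩
  unfold LinkedIn at hlink
  push Not at hlink
  obtain ⟨E, hE, hEne, hEne', hno⟩ := hlink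
  set C : Bool → Set (Fin N × Fin N) :=
    fun s => cond s E (((D : Set (Fin N × Fin N)) \ {l}) \ E) with hC
  have hCD : ∀ s, ∀ g ∈ C s, g ∈ D ∧ g ≠ l := by
    intro s g hg
    cases s
    · exact hg.1
    · exact hE hg
  have hCne : ∀ s, (C s).Nonempty := by
    intro s; cases s; exacts [hEne', hEne]
  have hCno : ∀ s, ∀ g ∈ C s, ∀ g' ∈ C (!s), ¬ Touch N D g g' := by
    intro s g hg g' hg' ht
    cases s
    · exact hno g' hg' g hg ht.symm
    · exact hno g hg g' hg' ht
  have hCcover : ∀ s, ∀ g ∈ D, g ∉ C s → g = l ∨ g ∈ C (!s) := by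
    intro s g hgD hg
    by_cases hgl : g = l
    · exact Or.inl hgl
    · right
      cases s
      · by_contra h
        exact hg ⟨⟨hgD, hgl⟩, h⟩
      · exact ⟨⟨hgD, hgl⟩, hg⟩
  have hadj : ∀ g, Touch N D l g → ∀ k, digit k l - digit k g ≤ 1 ∧ digit k g - digit k l ≤ 1 ∧
      0 ≤ digit k g ∧ digit k g < N := fun g hg k =>
    ⟨hg.digit_sub_le_one k, hg.symm.digit_sub_le_one k, digit_nonneg k g, digit_lt k g⟩
  -- As `l` is a corner, two of its neighbours off its line in direction `k` are equal or one step
  -- apart along `k`. They then touch, so they cannot belong to different classes.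
  obtain ⟨s, hs⟩ : ∃ s, ∀ g ∈ C s, Touch N D l g → digit (!k) g = digit (!k) l := by
    by_contra hcon
    push Not at hcon
    obtain ⟨g, hg, hlg, hgne⟩ := hcon true
    obtain ⟨g', hg', hlg', hgne'⟩ := hcon false
    have a1 := hadj g hlg k
    have a2 := hadj g hlg (!k)
    have a3 := hadj g' hlg' k
    have a4 := hadj g' hlg' (!k)
    have l1 := hl k
    have l2 := hl (!k)
    have e0 : digit (!k) g = digit (!k) g' := by omega
    have hkne : digit k g ≠ digit k g' := by
      intro h
      have hgg : g = g' := by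
        apply digit_ext
        intro k'
        rcases Bool.eq_or_eq_not k' k with rfl | rfl
        · exact h
        · exact e0
      exact hCno true g hg g' hg' (by
        obtain ⟨x, -, hx⟩ := hlg
        exact ⟨x, hx, hgg ▸ hx⟩)
    obtain ⟨z, hz, hz', -⟩ := hstep g g' e0 hkne (by omega) (by omega)
    exact hCno true g hg g' hg' ⟨z, hz, hz'⟩
  obtain ⟨h, hh, e, he, hte⟩ := linkedIn_digits hDne hF (C s) (fun g hg => (hCD s g hg).1) (hCne s)
    ⟨l, hlD, fun h => (hCD s l h).2 rfl⟩
  obtain rfl : e = l := (hCcover s e he.1 he.2).resolve_right fun h' => hCno s h hh e h' hte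
  have hh0 := hs h hh hte.symm
  have hhl : ∀ g ∈ C s, Touch N D e g → digit k g ≠ digit k e := by
    intro g hg ht h0
    apply (hCD s g hg).2
    apply digit_ext
    intro k'
    rcases Bool.eq_or_eq_not k' k with rfl | rfl
    · exact h0
    · exact hs g hg ht
  have huniq : ∀ g ∈ C s, Touch N D e g → g = h := by
    intro g hg ht
    apply digit_ext
    intro k'
    rcases Bool.eq_or_eq_not k' k with rfl | rfl
    · have := hhl g hg ht
      have := hhl h hh hte.symm
      have := hadj g ht k'
      have := hadj h hte.symm k'
      have := hl k'
      omega
    · rw [hs g hg ht, hh0]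
  have hadjh := hadj h hte.symm k
  obtain ⟨z, hzh, hze, hz⟩ := hstep h e hh0 (hhl h hh hte.symm) (by omega) (by omega)
  -- The class `C s` meets the rest only through its single neighbour `h` of the corner, and only at
  -- `z`.
  refine (IsFragileAt.of_set (p := z) (E := C s) (fun g hg => (hCD s g hg).1) (hCne s)
    ⟨e, hlD, fun h => (hCD s e h).2 rfl⟩ ?_).false_of_unique hN hF hS ?_
  · intro c hc d hd hdC x hxc hxd
    obtain rfl : d = e := (hCcover s d hd hdC).resolve_right fun h' =>
      hCno s c hc d h' ⟨x, hxc, hxd⟩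
    obtain rfl := huniq c hc ⟨x, hxd, hxc⟩
    exact hz x hxc hxd
  · intro t
    cases t
    · refine ⟨e, ⟨hlD, fun h => (hCD s e h).2 rfl⟩, hze, ?_⟩
      intro d hd hzd
      exact (hCcover s d hd.1 hd.2).resolve_right fun h' => hCno s h hh d h' ⟨z, hzh, hzd⟩
    · exact ⟨h, hh, hzh, fun d hd hzd => huniq d hd ⟨z, hze, hzd⟩⟩

theorem not_isFragileAt (hN : 2 ≤ N) (hF : IsConnected (gsc N D)) (hS : NoLargeSplit N D)
    {p : ℝ × ℝ} {C : Bool → Set (Fin N × Fin N)} : ¬ IsFragileAt N D p C := by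
  intro h
  by_cases hall : ∀ s, ∃ i ∈ C s, p ∈ cell N D i ∧ ∀ d ∈ C s, p ∈ cell N D d → d = i
  · exact h.false_of_unique hN hF hS hall
  push Not at hall
  obtain ⟨t, ht⟩ := hall
  obtain ⟨j₁, hj₁, hp₁⟩ := h.exists_mem hF t
  obtain ⟨j₂, hj₂, hp₂, hne⟩ := ht j₁ hj₁ hp₁
  obtain ⟨i, hi, hpi⟩ := h.exists_mem hF (!t)
  have hDne : D.Nonempty := ⟨i, h.sub _ hi⟩
  have hdis : ∀ a ∈ C (!t), ∀ b ∈ C t, a ≠ b := fun a ha b hb hab => h.disj t b hb (hab ▸ ha)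
  obtain ⟨j, hj, hpj, j', hj', hpj', hjj, k, hk⟩ : ∃ j ∈ C t, p ∈ cell N D j ∧ ∃ j' ∈ C t,
      p ∈ cell N D j' ∧ j' ≠ j ∧ ∃ k, digit (!k) i = digit (!k) j := by
    rcases exists_edge_adjacent hpi hp₁ hp₂ (Ne.symm hne) with h' | h'
    · exact ⟨j₁, hj₁, hp₁, j₂, hj₂, hp₂, hne, h'⟩
    · exact ⟨j₂, hj₂, hp₂, j₁, hj₁, hp₁, hne.symm, h'⟩
  have heq : ∀ a b : Fin N × Fin N, digit k a = digit k b → digit (!k) a = digit (!k) b → a = b := by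
    intro a b h1 h2
    apply digit_ext
    intro k'
    rcases Bool.eq_or_eq_not k' k with rfl | rfl
    · exact h1
    · exact h2
  have hkij : digit k i ≠ digit k j := fun h' => hdis i hi j hj (heq _ _ h' hk)
  have hthird : ∀ a, p ∈ cell N D a → a ≠ i → a ≠ j → digit (!k) a ≠ digit (!k) i := by
    intro a hpa hai haj h'
    rcases digit_eq_of_three hpi hpj hpa hkij with h1 | h1
    · exact hai (heq _ _ h1 h')
    · exact haj (heq _ _ h1 (h'.trans hk))
  have hj'i := hthird j' hpj' (hdis i hi j' hj').symm hjj
  have hsingle : ∀ x ∈ cell N D i, x ∈ cell N D j → x = p := fun x hxi hxj =>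
    h.single t j hj i hi x hxj hxi
  -- The cells `i`, `j`, `j'` place `p` at a corner of cell `i`. It remains to see whether the class
  -- of `i` has a second cell there.
  by_cases hu : ∀ d ∈ C (!t), p ∈ cell N D d → d = i
  · obtain ⟨l, hl, hpl⟩ := exists_mem_cell hDne (mem_cell.1 hpi)
    refine false_of_corner_not_linked hN hF hS hpi hpj hsingle hkij hk hl ?_
      (h.of_unique hN hF hS hi hpi hu hl hpl).2
    intro k'
    rcases Bool.eq_or_eq_not k' k with rfl | rfl
    · exact corner_digit hpi hpj hkij rfl hpl
    · exact corner_digit hpi hpj' hj'i.symm rfl hpl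
  · push Not at hu
    obtain ⟨i', hi', hpi', hii⟩ := hu
    have hi'i := hthird i' hpi' hii (hdis i' hi' j hj)
    have hi'j' : digit (!k) i' = digit (!k) j' :=
      ((digit_eq_of_three hpi hpj' hpi' hj'i.symm).resolve_left hi'i)
    have hki'j' : digit k i' ≠ digit k j' := fun h' => hdis i' hi' j' hj' (heq _ _ h' hi'j')
    have hx : ∃ x ∈ cell N D i, x ∈ cell N D j ∧ x ≠ p := by
      rcases digit_eq_of_three hpi hpj hpi' hkij with h1 | h1 <;>
        rcases digit_eq_of_three hpi hpj hpj' hkij with h2 | h2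
      · exact absurd (h1.trans h2.symm) hki'j'
      · exact exists_second_contact hpi' hpj' hk hi'j' hi'i h1 h2
      · exact exists_second_contact hpj' hpi' hk hi'j'.symm hj'i h2 h1
      · exact absurd (h1.trans h2.symm) hki'j'
    obtain ⟨x, hxi, hxj, hxp⟩ := hx
    exact hxp (hsingle x hxi hxj)

/-! ### Separations and their rescaling -/

/-- The carpet without the point `x` splits into the two relatively clopen non-empty parts
`s true` and `s false`. -/
structure IsSeparation (N : ℕ) (D : Finset (Fin N × Fin N)) (x : ℝ × ℝ)
    (s : Bool → Set (ℝ × ℝ)) : Prop where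
  sub : ∀ b, ∀ y ∈ s b, y ∈ gsc N D ∧ y ≠ x
  cover : ∀ y ∈ gsc N D, y ≠ x → ∃ b, y ∈ s b
  disj : ∀ b, ∀ y ∈ s b, y ∉ s (!b)
  nonempty : ∀ b, (s b).Nonempty
  closed : ∀ b, IsClosed (insert x (s b))

theorem exists_isSeparation (hD : D.Nonempty) {x : ℝ × ℝ} (hx : x ∈ gsc N D)
    (h : ¬ IsPreconnected (gsc N D \ {x})) : ∃ s, IsSeparation N D x s := by
  unfold IsPreconnected at h
  push Not at h
  obtain ⟨u, v, hu, hv, huv, hnu, hnv, hemp⟩ := h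
  have hcl : IsClosed (gsc N D) := (gsc_isAttractor N D hD).2.1.isClosed
  have hdis : ∀ y ∈ gsc N D, y ≠ x → y ∈ u → y ∉ v := fun y hy hyx hyu hyv => by
    have : y ∈ (gsc N D \ {x}) ∩ (u ∩ v) := ⟨⟨hy, hyx⟩, hyu, hyv⟩
    rw [hemp] at this
    exact this
  have hclosed : ∀ w w' : Set (ℝ × ℝ), IsOpen w' → gsc N D \ {x} ⊆ w ∪ w' →
      (∀ y ∈ gsc N D, y ≠ x → y ∈ w → y ∉ w') →
      IsClosed (insert x (gsc N D \ {x} ∩ w)) := by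
    intro w w' hw' hcov hdis
    have : insert x (gsc N D \ {x} ∩ w) = gsc N D ∩ (w' \ {x})ᶜ := by
      ext y
      by_cases hyx : y = x
      · subst hyx
        simp [hx]
      · constructor
        · rintro (rfl | ⟨⟨hy, -⟩, hyw⟩)
          · exact absurd rfl hyx
          · exact ⟨hy, fun h => hdis y hy hyx hyw h.1⟩
        · rintro ⟨hy, hyw⟩
          exact Or.inr ⟨⟨hy, hyx⟩, (hcov ⟨hy, hyx⟩).resolve_right fun h => hyw ⟨h, hyx⟩⟩
    rw [this]
    exact hcl.inter (hw'.sdiff isClosed_singleton).isClosed_compl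
  refine ⟨fun b => gsc N D \ {x} ∩ cond b u v, ?_, ?_, ?_, ?_, ?_⟩
  · intro b y hy
    exact hy.1
  · intro y hy hyx
    rcases huv ⟨hy, hyx⟩ with h | h
    · exact ⟨true, ⟨hy, hyx⟩, h⟩
    · exact ⟨false, ⟨hy, hyx⟩, h⟩
  · intro b y hy hy'
    cases b
    · exact hdis y hy.1.1 hy.1.2 hy'.2 hy.2
    · exact hdis y hy.1.1 hy.1.2 hy.2 hy'.2
  · intro b
    cases b
    exacts [hnv, hnu]
  · intro b
    cases b
    · exact hclosed v u hu (by rwa [Set.union_comm]) fun y hy hyx hyv hyu => hdis y hy hyx hyu hyv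
    · exact hclosed u v hv huv hdis

variable {x : ℝ × ℝ} {s : Bool → Set (ℝ × ℝ)}

theorem IsSeparation.subset_side (h : IsSeparation N D x s) {S : Set (ℝ × ℝ)}
    (hS : IsPreconnected S) (hSF : S ⊆ gsc N D) (hxS : x ∉ S) : ∃ b, S ⊆ s b := by
  have hne : ∀ y ∈ S, y ≠ x := fun y hy hyx => hxS (hyx ▸ hy)
  by_contra hcon
  push Not at hcon
  obtain ⟨y, hy, hyt⟩ := Set.not_subset.1 (hcon true)
  obtain ⟨z, hz, hzf⟩ := Set.not_subset.1 (hcon false)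
  have hother : ∀ b, ∀ y ∈ S, y ∉ s b → y ∈ s (!b) := by
    intro b y hy hyb
    obtain ⟨b', hb'⟩ := h.cover y (hSF hy) (hne y hy)
    rcases Bool.eq_or_eq_not b' b with rfl | rfl
    · exact absurd hb' hyb
    · exact hb'
  obtain ⟨w, hw, hw1, hw2⟩ := isPreconnected_closed_iff.1 hS _ _ (h.closed true) (h.closed false)
    (by
      intro y hy
      obtain ⟨b, hb⟩ := h.cover y (hSF hy) (hne y hy)
      cases b
      · exact Or.inr (Or.inr hb)
      · exact Or.inl (Or.inr hb))
    ⟨z, hz, Or.inr (hother false z hz hzf)⟩ ⟨y, hy, Or.inr (hother true y hy hyt)⟩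
  exact h.disj true w (hw1.resolve_left (hne w hw)) (hw2.resolve_left (hne w hw))

theorem IsSeparation.not_subset_not (h : IsSeparation N D x s) {S : Set (ℝ × ℝ)}
    (hS : S.Nonempty) {b : Bool} (hb : S ⊆ s b) : ¬ S ⊆ s (!b) := fun h' =>
  let ⟨y, hy⟩ := hS
  h.disj b y (hb hy) (h' hy)

/-- The trace of a separation on the cell `φ_i(F)`, rescaled to the whole carpet. -/
def zoomSep (D : Finset (Fin N × Fin N)) (i : Fin N × Fin N) (s : Bool → Set (ℝ × ℝ)) (b : Bool) :
    Set (ℝ × ℝ) :=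
  {y | y ∈ gsc N D ∧ gscMap N i y ∈ s b}

/-- The point to check is that both traces are nonempty. Otherwise one side lies in the union of the
cells other than `i`, a closed set missing `x`; that side is then closed by itself, against
connectedness of `F`. -/
theorem IsSeparation.rescale (hF : IsConnected (gsc N D)) (h : IsSeparation N D x s)
    {i : Fin N × Fin N} (hi : i ∈ D) (hxi : x ∈ cell N D i)
    (huniq : ∀ d ∈ D, x ∈ cell N D d → d = i) :
    IsSeparation N D (zoom i x) (zoomSep D i s) := by
  have hD : D.Nonempty := ⟨i, hi⟩
  have hcl : IsClosed (gsc N D) := (gsc_isAttractor N D hD).2.1.isClosed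
  have hne : ∀ y, y ≠ zoom i x ↔ gscMap N i y ≠ x := fun y => by
    rw [not_iff_not]
    constructor
    · rintro rfl; exact gscMap_zoom i x
    · rintro rfl; exact (zoom_gscMap i y).symm
  refine ⟨?_, ?_, ?_, ?_, ?_⟩
  · intro b y hy
    exact ⟨hy.1, (hne y).2 (h.sub b _ hy.2).2⟩
  · intro y hy hyx
    obtain ⟨b, hb⟩ := h.cover _ (cell_subset hi (gscMap_mem_cell hy)) ((hne y).1 hyx)
    exact ⟨b, hy, hb⟩
  · intro b y hy hy'
    exact h.disj b _ hy.2 hy'.2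
  · intro b
    by_contra hemp
    rw [Set.not_nonempty_iff_eq_empty] at hemp
    set R : Set (ℝ × ℝ) := ⋃ d ∈ (D : Set (Fin N × Fin N)) \ {i}, cell N D d with hR
    have hRcl : IsClosed R := (Set.toFinite _).isClosed_biUnion fun d _ => isClosed_cell hD d
    have hxR : x ∉ R := by
      simp only [hR, Set.mem_iUnion, not_exists]
      exact fun d hd hxd => hd.2 (huniq d hd.1 hxd)
    have hsR : s b ⊆ R := by
      intro y hy
      obtain ⟨d, hd, hyd⟩ := exists_mem_cell hD (h.sub b y hy).1
      refine Set.mem_biUnion (show d ∈ (D : Set _) \ {i} from ⟨hd, ?_⟩) hyd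
      rintro rfl
      have : zoom d y ∈ zoomSep D d s b := ⟨mem_cell.1 hyd, by rwa [gscMap_zoom]⟩
      rw [hemp] at this
      exact this
    obtain ⟨w, hw, hw1, hw2⟩ := isPreconnected_closed_iff.1 hF.isPreconnected
      (insert x (s b) ∩ R) (insert x (s (!b))) ((h.closed b).inter hRcl) (h.closed _)
      (by
        intro y hy
        by_cases hyx : y = x
        · exact Or.inr (Or.inl hyx)
        · obtain ⟨b', hb'⟩ := h.cover y hy hyx
          rcases Bool.eq_or_eq_not b' b with rfl | rfl
          · exact Or.inl ⟨Or.inr hb', hsR hb'⟩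
          · exact Or.inr (Or.inr hb'))
      (by
        obtain ⟨y, hy⟩ := h.nonempty b
        exact ⟨y, (h.sub b y hy).1, Or.inr hy, hsR hy⟩)
      ⟨x, cell_subset hi hxi, Or.inl rfl⟩
    have hwx : w ≠ x := fun h => hxR (h ▸ hw1.2)
    exact h.disj b w (hw1.1.resolve_left hwx) (hw2.resolve_left hwx)
  · intro b
    have : insert (zoom i x) (zoomSep D i s b) =
        gsc N D ∩ gscMap N i ⁻¹' insert x (s b) := by
      ext y
      by_cases hy : y = zoom i x
      · subst hy
        simp [gscMap_zoom, mem_cell.1 hxi]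
      · simp only [Set.mem_insert_iff, hy, false_or, zoomSep, Set.mem_ofPred_eq, Set.mem_inter_iff,
          Set.mem_preimage, (hne y).1 hy]
    rw [this]
    exact hcl.inter ((h.closed b).preimage (gscMap_continuous N i))

theorem mem_word {i l a b : Fin N × Fin N} (ha : a ∈ D) (hb : b ∈ D)
    (hi : ∀ d ∈ D, x ∈ cell N D d → d = i) (hl : ∀ d ∈ D, zoom i x ∈ cell N D d → d = l)
    (h : x ∈ gscMap N a '' cell N D b) : (a, b) = (i, l) := by
  obtain ⟨y, hy, rfl⟩ := h
  obtain rfl := hi a ha (gscMap_mem_cell (cell_subset hb hy))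
  rw [zoom_gscMap] at hl
  rw [hl b hb hy]

/-- The cell of any word other than `il` is connected and misses `x`, so the sides of the separation
split the words. -/
theorem IsSeparation.false_of_words (hF : IsConnected (gsc N D)) (hS : NoLargeSplit N D)
    (h : IsSeparation N D x s) {i l : Fin N × Fin N} (hiD : i ∈ D) (hlD : l ∈ D)
    (hi : ∀ d ∈ D, x ∈ cell N D d → d = i) (hl : ∀ d ∈ D, zoom i x ∈ cell N D d → d = l)
    (hbig : ∀ b, (∃ c ∈ D, c ≠ i ∧ cell N D c ⊆ s b) ∨
      (LinkedIn (Touch N D) ((D : Set (Fin N × Fin N)) \ {l}) ∧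
        ∀ d ∈ D, d ≠ l → gscMap N i '' cell N D d ⊆ s b)) : False := by
  refine hS i hiD l hlD (fun b a c => gscMap N a '' cell N D c ⊆ s b) ?_ ?_ ?_
  · intro a _ b _ c _ e _ _ _ hab hce
    rw [Set.disjoint_left]
    exact fun y hy hy' => h.disj true y (hab hy) (hce hy')
  · intro a ha b hb hab
    obtain ⟨t, ht⟩ := h.subset_side (S := gscMap N a '' cell N D b)
      ((isConnected_cell hF b).image _ (gscMap_continuous N a).continuousOn).isPreconnected
      ((Set.image_mono (cell_subset hb)).trans (cell_subset ha))
      (fun hx => hab (mem_word ha hb hi hl hx))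
    cases t
    · exact Or.inr ht
    · exact Or.inl ht
  · intro b
    rcases hbig b with ⟨c, hc, hci, hcs⟩ | h'
    · exact Or.inl ⟨c, hc, hci, fun d hd => (Set.image_mono (cell_subset hd)).trans hcs⟩
    · exact Or.inr h'

/-- If `x` has a unique second-level code, all first-level cells not containing `x` lie on the
same side. -/
theorem IsSeparation.exists_side (hF : IsConnected (gsc N D)) (hS : NoLargeSplit N D)
    (h : IsSeparation N D x s) {i l : Fin N × Fin N} (hiD : i ∈ D) (hlD : l ∈ D)
    (hi : ∀ d ∈ D, x ∈ cell N D d → d = i) (hl : ∀ d ∈ D, zoom i x ∈ cell N D d → d = l) :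
    ∃ b, ∀ d ∈ D, d ≠ i → cell N D d ⊆ s b := by
  by_contra hcon
  push Not at hcon
  refine h.false_of_words hF hS hiD hlD hi hl fun b => Or.inl ?_
  obtain ⟨d, hd, hdi, hdb⟩ := hcon (!b)
  obtain ⟨t, ht⟩ := h.subset_side (isConnected_cell hF d).isPreconnected (cell_subset hd)
    fun hx => hdi (hi d hd hx)
  rcases Bool.eq_or_eq_not t b with rfl | rfl
  · exact ⟨d, hd, hdi, ht⟩
  · exact absurd ht hdb

/-- The words `i d` with `d ≠ l` are on side `!b`, all words outside `i` on side `b`. So a splitting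
of `D \ {i}` persists after `il` alone is deleted, and linkedness of `D \ {l}` would make side `!b`
large. -/
theorem IsSeparation.linkedIn_of_alternating (hF : IsConnected (gsc N D)) (hS : NoLargeSplit N D)
    (hD : 1 < D.card) (h : IsSeparation N D x s) {i l : Fin N × Fin N} (hiD : i ∈ D)
    (hlD : l ∈ D) (hi : ∀ d ∈ D, x ∈ cell N D d → d = i)
    (hl : ∀ d ∈ D, zoom i x ∈ cell N D d → d = l) {b : Bool}
    (hb : ∀ d ∈ D, d ≠ i → cell N D d ⊆ s b)
    (hb' : ∀ d ∈ D, d ≠ l → cell N D d ⊆ zoomSep D i s (!b)) :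
    LinkedIn (Touch N D) ((D : Set (Fin N × Fin N)) \ {i}) ∧
      ¬ LinkedIn (Touch N D) ((D : Set (Fin N × Fin N)) \ {l}) := by
  have hinner : ∀ d ∈ D, d ≠ l → gscMap N i '' cell N D d ⊆ s (!b) := by
    rintro d hd hdl _ ⟨y, hy, rfl⟩
    exact (hb' d hd hdl hy).2
  constructor
  · by_contra hlink
    unfold LinkedIn at hlink
    push Not at hlink
    obtain ⟨E, hE, ⟨e₁, he₁⟩, ⟨e₂, he₂⟩, hno⟩ := hlink
    refine hS i hiD l hlD (fun t a _ => cond t (a ∈ E) (a ∉ E)) ?_ ?_ ?_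
    · intro a ha a' ha' c hc c' hc' _ hne haE hcE
      rw [Set.disjoint_left]
      intro y hy hy'
      have hya := Set.image_mono (cell_subset ha') hy
      have hyc := Set.image_mono (cell_subset hc') hy'
      by_cases hci : c = i
      · subst hci
        exact h.disj b y (hb a ha (hE haE).2 hya)
          (hinner c' hc' (fun h => hne (by rw [h])) hy')
      · exact hno a haE c ⟨⟨hc, hci⟩, hcE⟩ ⟨y, hya, hyc⟩
    · intro a _ _ _ _
      exact em (a ∈ E)
    · intro t
      left
      cases t
      · exact ⟨e₂, he₂.1.1, he₂.1.2, fun _ _ => he₂.2⟩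
      · exact ⟨e₁, (hE he₁).1, (hE he₁).2, fun _ _ => he₁⟩
  · intro hlink
    refine h.false_of_words hF hS hiD hlD hi hl fun t => ?_
    rcases Bool.eq_or_eq_not t b with rfl | rfl
    · obtain ⟨c, hc, hci⟩ := Finset.exists_mem_ne hD i
      exact Or.inl ⟨c, hc, hci, hb c hc hci⟩
    · exact Or.inr ⟨hlink, hinner⟩

theorem IsSeparation.descend {x y : ℝ × ℝ} {s : Bool → Set (ℝ × ℝ)} (h : IsSeparation N D x s)
    {i : Fin N × Fin N} (hiD : i ∈ D) {b : Bool}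
    (hb : ∀ d ∈ D, d ≠ i → cell N D d ⊆ s b) (hy : y ∈ s (!b)) :
    y ∈ cell N D i ∧ zoom i y ∈ zoomSep D i s (!b) := by
  obtain ⟨d, hd, hyd⟩ := exists_mem_cell ⟨i, hiD⟩ (h.sub _ y hy).1
  obtain rfl : d = i := by
    by_contra hdi
    exact h.disj b y (hb d hd hdi hyd) hy
  exact ⟨hyd, mem_cell.1 hyd, by rwa [gscMap_zoom]⟩

/-! ### Points whose whole orbit has unique codes -/

/-- Two points of the grid of mesh `1 / N` lying in a common second-level square coincide. -/
theorem eq_of_lattice (hN : 2 ≤ N) {a b : ℝ × ℝ} {c e : Fin N × Fin N}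
    (ha : ∀ k, ∃ m : ℤ, N * coord k a = m) (hb : ∀ k, ∃ m : ℤ, N * coord k b = m)
    (hac : zoom c a ∈ cell N D e) (hbc : zoom c b ∈ cell N D e) : a = b := by
  have hdist := dist_le_one (mem_cell.1 hac) (mem_cell.1 hbc)
  rw [dist_zoom, dist_zoom] at hdist
  have hN' : (2 : ℝ) ≤ N := by exact_mod_cast hN
  refine coord_ext fun k => ?_
  obtain ⟨m, hm⟩ := ha k
  obtain ⟨m', hm'⟩ := hb k
  have h1 := coord_dist_le k a b
  have h2 : (N : ℝ) * |(m : ℝ) - m'| ≤ 1 := by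
    rw [← hm, ← hm', ← mul_sub, abs_mul, abs_of_nonneg (by linarith : (0 : ℝ) ≤ N)]
    refine le_trans ?_ hdist
    gcongr
  have h3 : |(m : ℝ) - m'| < 1 := by
    by_contra hcon
    push Not at hcon
    nlinarith
  have h4 : |m - m'| < 1 := by exact_mod_cast h3
  have h5 : m = m' := by rw [Int.abs_lt_one_iff] at h4; omega
  have : (N : ℝ) ≠ 0 := by linarith
  exact mul_left_cancel₀ this (by rw [hm, hm', h5])

/-- A point all of whose iterates lie in a single first-level cell does not separate the carpet. -/
theorem false_of_separation_seq (hN : 2 ≤ N) (hD : 1 < D.card) (hF : IsConnected (gsc N D))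
    (hS : NoLargeSplit N D) (x : ℕ → ℝ × ℝ) (i : ℕ → Fin N × Fin N)
    (s : ℕ → Bool → Set (ℝ × ℝ)) (hiD : ∀ n, i n ∈ D)
    (hxF : ∀ n, x n ∈ gsc N D)
    (huniq : ∀ n, ∀ d ∈ D, x n ∈ cell N D d → d = i n)
    (hx : ∀ n, x (n + 1) = zoom (i n) (x n)) (hs : ∀ n, s (n + 1) = zoomSep D (i n) (s n))
    (hsep : ∀ n, IsSeparation N D (x n) (s n)) : False := by
  have hDne : D.Nonempty := ⟨_, hiD 0⟩
  have hl : ∀ n, ∀ d ∈ D, zoom (i n) (x n) ∈ cell N D d → d = i (n + 1) := fun n => by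
    rw [← hx]; exact huniq (n + 1)
  have hXex : ∀ n, ∃ b, ∀ d ∈ D, d ≠ i n → cell N D d ⊆ s n b := fun n =>
    (hsep n).exists_side hF hS (hiD n) (hiD (n + 1)) (huniq n) (hl n)
  choose X hX using hXex
  have halt : ∀ n, X (n + 1) ≠ X n →
      LinkedIn (Touch N D) ((D : Set (Fin N × Fin N)) \ {i n}) ∧
      ¬ LinkedIn (Touch N D) ((D : Set (Fin N × Fin N)) \ {i (n + 1)}) := by
    intro n hn
    refine (hsep n).linkedIn_of_alternating hF hS hD (hiD n) (hiD (n + 1)) (huniq n) (hl n)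
      (hX n) ?_
    rw [← hs, ← (Bool.eq_or_eq_not (X (n + 1)) (X n)).resolve_left hn]
    exact hX (n + 1)
  have hstay : ∀ n, ¬ LinkedIn (Touch N D) ((D : Set (Fin N × Fin N)) \ {i n}) →
      X (n + 1) = X n := fun n hn => by
    by_contra h
    exact hn (halt n h).1
  have hdescend : ∀ n b, X n = !b → ∀ y ∈ s n b,
      y ∈ cell N D (i n) ∧ zoom (i n) y ∈ s (n + 1) b := by
    intro n b hb y hy
    have := (hsep n).descend (hiD n) (hX n) (y := y) (by rw [hb, Bool.not_not]; exact hy)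
    rwa [hb, Bool.not_not, ← hs] at this
  -- With a constant side, a point of the opposite side stays in the cells `i n`, and its distance
  -- to `x n` grows like `N ^ k`, beyond the diameter bound `1`.
  have hnconst : ∀ n, ¬ ∀ k, X (n + k) = X n := by
    intro n hconst
    obtain ⟨y, hy⟩ := (hsep n).nonempty (!X n)
    have hpos : 0 < dist y (x n) := dist_pos.2 ((hsep n).sub _ y hy).2
    have hk : ∀ k : ℕ, ∃ z ∈ s (n + k) (!X n),
        dist z (x (n + k)) = (N : ℝ) ^ k * dist y (x n) := by
      intro k
      induction k with
      | zero => exact ⟨y, hy, by simp⟩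
      | succ k ih =>
        obtain ⟨z, hz, hdist⟩ := ih
        refine ⟨_, (hdescend (n + k) (!X n) (by rw [Bool.not_not, hconst]) z hz).2, ?_⟩
        rw [← add_assoc, hx, dist_zoom, hdist, pow_succ]
        ring
    have hN1 : (1 : ℝ) < N := by exact_mod_cast hN
    obtain ⟨k, hk1⟩ := pow_unbounded_of_one_lt (1 / dist y (x n)) hN1
    obtain ⟨z, hz, hdist⟩ := hk k
    have h1 := dist_le_one ((hsep (n + k)).sub _ z hz).1 (hxF (n + k))
    rw [hdist] at h1
    rw [div_lt_iff₀ hpos] at hk1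
    linarith
  obtain ⟨m, hm⟩ : ∃ m, X (m + 1) ≠ X m := by
    by_contra hcon
    push Not at hcon
    refine hnconst 0 fun k => ?_
    induction k with
    | zero => rfl
    | succ k ih => rw [← add_assoc, hcon, ih]
  have hm1 : X (m + 1) = !X m := (Bool.eq_or_eq_not _ _).resolve_left hm
  have hnl := (halt m hm).2
  -- Two consecutive changes are impossible: the first leaves `D \ {i (m + 1)}` unlinked, the second
  -- needs it linked.
  have hm2 : X (m + 1 + 1) = !X m := by rw [hstay _ hnl, hm1]
  -- Contacts of cell `i m` rescale to points on side `X m`, opposite to the other cells at the next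
  -- two levels, so their next two digits are forced.
  have hcontact : ∀ e ∈ D, e ≠ i m → ∀ y ∈ gsc N D, gscMap N (i m) y ∈ cell N D e →
      y ∈ s (m + 1) (X m) := by
    intro e he hei y hy hye
    rw [hs]
    exact ⟨hy, hX m e he hei hye⟩
  by_cases hfix : ∃ e ∈ D, e ≠ i m ∧ ∃ c ∈ D, gscMap N (i m) (fixedPt c) ∈ cell N D e
  · obtain ⟨e, he, hei, c, hc, hce⟩ := hfix
    have hq := hcontact e he hei _ (fixedPt_mem hN hc) hce
    have hcode : ∀ n, X n = (!X m) → fixedPt c ∈ s n (X m) →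
        i n = c ∧ fixedPt c ∈ s (n + 1) (X m) := by
      intro n hn hqn
      obtain ⟨h1, h2⟩ := hdescend n (X m) hn _ hqn
      have h3 := eq_of_fixedPt_mem_cell hN h1
      refine ⟨h3, ?_⟩
      rwa [h3, zoom_fixedPt hN] at h2
    have hc1 : i (m + 1) = c := (hcode _ hm1 hq).1
    rw [hc1] at hnl
    -- The fixed point of `c` stays on the opposite side, which forces `i n = c`; as `D \ {c}` is
    -- unlinked, the side cannot change.
    have hall : ∀ k, X (m + 1 + k) = (!X m) ∧ fixedPt c ∈ s (m + 1 + k) (X m) := by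
      intro k
      induction k with
      | zero => exact ⟨hm1, hq⟩
      | succ k ih =>
        obtain ⟨h1, h2⟩ := hcode _ ih.1 ih.2
        exact ⟨by rw [← add_assoc, hstay _ (by rwa [h1]), ih.1], h2⟩
    exact hnconst (m + 1) fun k => by rw [(hall k).1, hm1]
  · have hlat : ∀ e ∈ D, e ≠ i m → ∀ y ∈ cell N D (i m), y ∈ cell N D e →
        (∀ k, ∃ n : ℤ, N * coord k (zoom (i m) y) = n) ∧
        zoom (i (m + 1)) (zoom (i m) y) ∈ cell N D (i (m + 1 + 1)) := by
      intro e he hei y hyi hye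
      constructor
      · refine (contact_dichotomy hN hei.symm hyi hye hDne).resolve_left ?_
        rintro ⟨c, hc, hce⟩
        exact hfix ⟨e, he, hei, c, hc, hce⟩
      · have h1 := hcontact e he hei _ (mem_cell.1 hyi) (by rwa [gscMap_zoom])
        exact (hdescend _ _ hm2 _ (hdescend _ _ hm1 _ h1).2).1
    have hne' : ((D : Set (Fin N × Fin N)) \ {i m}).Nonempty := by
      obtain ⟨c, hc, hci⟩ := Finset.exists_mem_ne hD (i m)
      exact ⟨c, hc, hci⟩
    have hsub : ({i m} : Set (Fin N × Fin N)) ⊆ D := Set.singleton_subset_iff.2 (hiD m)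
    obtain ⟨a, rfl, e, he, p, hpi, hpe⟩ := linkedIn_digits hDne hF _ hsub
      (Set.singleton_nonempty _) hne'
    -- All contacts of cell `i m` are grid points in one second-level square after rescaling, hence
    -- one point.
    refine not_isFragileAt hN hF hS (IsFragileAt.of_set (p := p) hsub
      (Set.singleton_nonempty _) hne' ?_)
    rintro _ rfl e' he' he'i y hyi hye
    have h1 := hlat e he.1 he.2 p hpi hpe
    have h2 := hlat e' he' he'i y hyi hye
    have h3 := eq_of_lattice hN h2.1 h1.1 h2.2 h1.2
    rw [← gscMap_zoom (i m) y, h3, gscMap_zoom]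

/-! ### Points in several cells, and the conclusion -/

/-- A separating point of two first-level cells, none of which it separates, makes the carpet
fragile. -/
theorem IsSeparation.false_of_cells (hN : 2 ≤ N) (hF : IsConnected (gsc N D))
    (hS : NoLargeSplit N D) {x : ℝ × ℝ} {s : Bool → Set (ℝ × ℝ)} (h : IsSeparation N D x s)
    (hcell : ∀ d ∈ D, IsPreconnected (cell N D d \ {x})) (hD : D.Nonempty) : False := by
  have hside : ∀ d ∈ D, ∃ b, cell N D d \ {x} ⊆ s b := fun d hd =>
    h.subset_side (hcell d hd) (Set.sdiff_subset.trans (cell_subset hd)) fun hx => hx.2 rfl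
  set E : Set (Fin N × Fin N) := {d | d ∈ D ∧ cell N D d \ {x} ⊆ s true} with hE
  have hnot : ∀ d ∈ D, d ∉ E → cell N D d \ {x} ⊆ s false := by
    intro d hd hdE
    obtain ⟨b, hb⟩ := hside d hd
    cases b
    · exact hb
    · exact absurd ⟨hd, hb⟩ hdE
  refine not_isFragileAt hN hF hS (IsFragileAt.of_set (p := x) (E := E) (fun d hd => hd.1) ?_ ?_ ?_)
  · obtain ⟨y, hy⟩ := h.nonempty true
    obtain ⟨hyF, hyx⟩ := h.sub _ y hy
    obtain ⟨d, hd, hyd⟩ := exists_mem_cell hD hyF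
    refine ⟨d, ?_⟩
    by_contra hdE
    exact h.disj _ y hy (hnot d hd hdE ⟨hyd, hyx⟩)
  · obtain ⟨y, hy⟩ := h.nonempty false
    obtain ⟨hyF, hyx⟩ := h.sub _ y hy
    obtain ⟨d, hd, hyd⟩ := exists_mem_cell hD hyF
    exact ⟨d, hd, fun hdE => h.disj _ y hy (hdE.2 ⟨hyd, hyx⟩)⟩
  · intro c hc e he heE y hyc hye
    by_contra hyx
    exact h.disj _ y (hc.2 ⟨hyc, hyx⟩) (hnot e he heE ⟨hye, hyx⟩)

theorem isPreconnected_cell_sdiff {d : Fin N × Fin N} {x : ℝ × ℝ}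
    (h : IsPreconnected (gsc N D \ {zoom d x})) : IsPreconnected (cell N D d \ {x}) := by
  have : cell N D d \ {x} = gscMap N d '' (gsc N D \ {zoom d x}) := by
    rw [Set.image_sdiff (gscMap_injective d), Set.image_singleton, gscMap_zoom]
    rfl
  rw [this]
  exact h.image _ (gscMap_continuous N d).continuousOn

/-- Non-separation propagates along the code map: if a set of points is stable under rescaling
and the rescalings of its points with several codes do not separate, no point of it separates. -/
theorem isPreconnected_sdiff_of_stable (hN : 2 ≤ N) (hD : 1 < D.card)
    (hF : IsConnected (gsc N D)) (hS : NoLargeSplit N D) {S : Set (ℝ × ℝ)} (hSF : S ⊆ gsc N D)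
    (hstable : ∀ x ∈ S, ∀ d ∈ D, x ∈ cell N D d → zoom d x ∈ S)
    (hmulti : ∀ x ∈ S, ∀ d ∈ D, ∀ e ∈ D, d ≠ e → x ∈ cell N D d → x ∈ cell N D e →
      IsPreconnected (gsc N D \ {zoom d x})) {x : ℝ × ℝ} (hx : x ∈ S) :
    IsPreconnected (gsc N D \ {x}) := by
  have hDne : D.Nonempty := Finset.card_pos.1 (by omega)
  by_contra hcon
  obtain ⟨s, hs⟩ := exists_isSeparation hDne (hSF hx) hcon
  choose f hfD hf using fun y : S => exists_mem_cell hDne (hSF y.2)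
  let T : S → S := fun y => ⟨zoom (f y) y, hstable y y.2 (f y) (hfD y) (hf y)⟩
  let xs : ℕ → S := fun n => Nat.rec ⟨x, hx⟩ (fun _ y => T y) n
  let ss : ℕ → Bool → Set (ℝ × ℝ) := fun n => Nat.rec s (fun n t => zoomSep D (f (xs n)) t) n
  have hstep : ∀ n, IsSeparation N D (xs n).1 (ss n) →
      (∀ d ∈ D, (xs n).1 ∈ cell N D d → d = f (xs n)) →
      IsSeparation N D (xs (n + 1)).1 (ss (n + 1)) := by
    intro n h hu
    exact h.rescale hF (hfD (xs n)) (hf (xs n)) hu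
  have hseq : ∀ n, (∀ m < n, ∀ d ∈ D, (xs m).1 ∈ cell N D d → d = f (xs m)) →
      IsSeparation N D (xs n).1 (ss n) := by
    intro n
    induction n with
    | zero => exact fun _ => hs
    | succ n ih => exact fun h => hstep n (ih fun m hm => h m (by omega)) (h n (by omega))
  -- Either the orbit never meets several cells, or the separation is carried to the first time it
  -- does.
  by_cases hall : ∀ n, ∀ d ∈ D, (xs n).1 ∈ cell N D d → d = f (xs n)
  · exact false_of_separation_seq hN hD hF hS (fun n => (xs n).1) (fun n => f (xs n)) ss
      (fun n => hfD _) (fun n => hSF (xs n).2) hall (fun n => rfl) (fun n => rfl) fun n => hseq n fun m _ => hall m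
  · classical
    rw [not_forall] at hall
    have hsep := hseq (Nat.find hall) fun m hm => not_not.1 (Nat.find_min hall hm)
    have hfind := Nat.find_spec hall
    set n := Nat.find hall
    push Not at hfind
    obtain ⟨e, heD, he, hef⟩ := hfind
    refine hsep.false_of_cells hN hF hS (fun d hd => ?_) hDne
    by_cases hxd : (xs n).1 ∈ cell N D d
    · apply isPreconnected_cell_sdiff
      by_cases hde : d = e
      · exact hmulti _ (xs n).2 d hd _ (hfD (xs n)) (hde ▸ hef) hxd (hf _)
      · exact hmulti _ (xs n).2 d hd e heD hde hxd he
    · rw [Set.sdiff_singleton_eq_self hxd]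
      exact (isConnected_cell hF d).isPreconnected

theorem zoom_extreme {x : ℝ × ℝ} {d : Fin N × Fin N} {k : Bool}
    (hd : x ∈ cell N D d) (h : coord k x = 0 ∨ coord k x = 1) :
    coord k (zoom d x) = coord k x ∧ (digit k d : ℝ) = (N - 1) * coord k x := by
  have h1 := coord_mem (mem_cell.1 hd) k
  have h2 : (0 : ℝ) ≤ digit k d := by exact_mod_cast digit_nonneg k d
  have h3 := digit_le_sub_one k d
  rw [coord_zoom] at h1 ⊢
  rcases h with h | h
  · rw [h] at h1 ⊢
    constructor <;> linarith [h1.1]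
  · rw [h] at h1 ⊢
    constructor <;> linarith [h1.2]

theorem digit_eq_of_extreme {x : ℝ × ℝ} {d e : Fin N × Fin N} {k : Bool}
    (hd : x ∈ cell N D d) (he : x ∈ cell N D e) (h : coord k x = 0 ∨ coord k x = 1) :
    digit k d = digit k e := by
  have := (zoom_extreme hd h).2.trans (zoom_extreme he h).2.symm
  exact_mod_cast this

theorem extreme_of_digit_ne {x : ℝ × ℝ} {d e : Fin N × Fin N} {k : Bool}
    (hd : x ∈ cell N D d) (he : x ∈ cell N D e) (h : digit k d ≠ digit k e) :
    coord k (zoom d x) = 0 ∨ coord k (zoom d x) = 1 := by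
  have h1 := coord_mem (mem_cell.1 hd) k
  have h2 := coord_mem (mem_cell.1 he) k
  have h3 := coord_zoom_sub_coord_zoom d e x k
  have h4 := digit_sub_le_one hd he k
  have h5 := digit_sub_le_one he hd k
  obtain h6 | h6 : digit k e - digit k d = 1 ∨ digit k e - digit k d = -1 := by omega
  · rw [h6] at h3
    push_cast at h3
    right; linarith [h1.2, h2.1]
  · rw [h6] at h3
    push_cast at h3
    left; linarith [h1.1, h2.2]

/-- Corners, boundary points and all of `F` are each stable under rescaling; each case supplies
`hmulti` for the next, and for corners it is vacuous. -/
theorem isPreconnected_sdiff_singleton (hN : 2 ≤ N) (hD : 1 < D.card)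
    (hF : IsConnected (gsc N D)) (hS : NoLargeSplit N D) {x : ℝ × ℝ} (hx : x ∈ gsc N D) :
    IsPreconnected (gsc N D \ {x}) := by
  have hcorner : ∀ x ∈ {x | x ∈ gsc N D ∧ ∀ k, coord k x = 0 ∨ coord k x = 1},
      IsPreconnected (gsc N D \ {x}) := fun x hx =>
    isPreconnected_sdiff_of_stable (S := {x | x ∈ gsc N D ∧ ∀ k, coord k x = 0 ∨ coord k x = 1}) hN hD hF hS
      (fun x hx => hx.1)
      (fun x hx d _ hxd => ⟨mem_cell.1 hxd, fun k => by
        rw [(zoom_extreme hxd (hx.2 k)).1]; exact hx.2 k⟩)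
      (fun x hx d _ e _ hde hxd hxe =>
        absurd (digit_ext fun k => digit_eq_of_extreme hxd hxe (hx.2 k)) hde) hx
  have hboundary : ∀ x ∈ {x | x ∈ gsc N D ∧ ∃ k, coord k x = 0 ∨ coord k x = 1},
      IsPreconnected (gsc N D \ {x}) := fun x hx =>
    isPreconnected_sdiff_of_stable (S := {x | x ∈ gsc N D ∧ ∃ k, coord k x = 0 ∨ coord k x = 1}) hN hD hF hS
      (fun x hx => hx.1)
      (fun x hx d _ hxd => ⟨mem_cell.1 hxd, hx.2.imp fun k hk => by
        rw [(zoom_extreme hxd hk).1]; exact hk⟩)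
      (fun x hx d _ e _ hde hxd hxe => by
        obtain ⟨k, hk⟩ := hx.2
        have h0 := digit_eq_of_extreme hxd hxe hk
        refine hcorner _ ⟨mem_cell.1 hxd, fun k' => ?_⟩
        rcases Bool.eq_or_eq_not k' k with rfl | rfl
        · rw [(zoom_extreme hxd hk).1]; exact hk
        · refine extreme_of_digit_ne hxd hxe fun h1 => hde (digit_ext fun k' => ?_)
          rcases Bool.eq_or_eq_not k' k with rfl | rfl
          · exact h0
          · exact h1) hx
  refine isPreconnected_sdiff_of_stable hN hD hF hS le_rfl (fun x _ d _ hxd => mem_cell.1 hxd)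
    (fun x _ d _ e _ hde hxd hxe => ?_) hx
  obtain ⟨k, hk⟩ : ∃ k, digit k d ≠ digit k e := by
    by_contra hcon
    push Not at hcon
    exact hde (digit_ext hcon)
  exact hboundary _ ⟨mem_cell.1 hxd, k, extreme_of_digit_ne hxd hxe hk⟩

/-- Needed because `IsConnected` includes non-emptiness of `F` without the point. -/
theorem gsc_nontrivial (hN : 2 ≤ N) (hD : 1 < D.card) : (gsc N D).Nontrivial := by
  obtain ⟨c, hc, e, he, hce⟩ := Finset.one_lt_card.1 hD
  refine ⟨fixedPt c, fixedPt_mem hN hc, fixedPt e, fixedPt_mem hN he, fun h => hce ?_⟩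
  refine eq_of_fixedPt_mem_cell (D := D) hN ?_
  rw [mem_cell, ← h, zoom_fixedPt hN]
  exact fixedPt_mem hN hc

end Carpet

/-- A connected generalized Sierpiński carpet `F(N,D)` with `χ(Γ₂) < |D| - 1` has no cut
points. -/
theorem corollary1p5 (N : ℕ) (hN : 2 ≤ N) (D : Finset (Fin N × Fin N))
    (hD : 1 < D.card) (hD' : D.card < N ^ 2)
    (hconn : IsConnected (gsc N D))
    (hchi : chi (hataGraph N D 2) < D.card - 1) :
    ∀ x, ¬ IsCutPoint (gsc N D) x := by
  rintro x ⟨hx, hcut⟩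
  obtain ⟨y, hy, hyx⟩ := (gsc_nontrivial hN hD).exists_ne x
  exact hcut ⟨⟨y, hy, hyx⟩, isPreconnected_sdiff_singleton hN hD hconn
    (noLargeSplit_of_chi_lt hD hconn hchi) hx⟩
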